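/- **Setting.** Let $\boldsymbol\theta=(\theta^{(n)})_{n\ge 0}$ be a constant-length directive sequence with length sequence $(q_n)_{n\ge0}$: the $\mathcal A_n$ are finite alphabets and $\theta^{(n)}\colon\mathcal A_{n+1}\to\mathcal A_n^+$ is a morphism all of whose letter images have length $q_n$. Assume that $\sup_n|\mathcal A_n|<\infty$ (bounded alphabets). Write $\theta^{[m,n)}=\theta^{(m)}\circ\cdots\circ\theta^{(n-1)}$ and $p_n=q_0\cdots q_{n-1}$. Let $X^{(n)}\subseteq\mathcal A_n^{\mathbb Z}$ be the set of two-sided sequences all of whose finite subwords are subwords of $\theta^{[n,N)}(a)$ for some $N>n$ and $a\in\mathcal A_N$, let $X_{\boldsymbol\theta}=X^{(0)}$, and let $\sigma$ be the left shift. Let $\mathbb Z_{(q_n)}=\varprojlim\mathbb Z/p_n\mathbb Z$ be the odometer. A *tiling factor map* is a continuous surjection $\pi\colon X_{\boldsymbol\theta}\to\mathbb Z_{(q_n)}$ with $\pi(\sigma x)=\pi(x)+1$. * $\boldsymbol\theta$ is *quasi-recognizable* if every $(X^{(n)},\sigma)$ is minimal and a tiling factor map exists. * $\boldsymbol\theta$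 is *injective* if every $\theta^{(n)}$ is injective on letters. * $\boldsymbol\theta$ is *torsion-free* if $q_n>1$ for infinitely many $n$, every $(X^{(n)},\sigma)$ is minimal, $X_{\boldsymbol\theta}$ has no shift-periodic point, and each prime dividing some $q_k$ divides $q_n$ for infinitely many $n$. * The *injectivisation* $\widehat{\boldsymbol\theta}$ of $\boldsymbol\theta$ is defined recursively: $\tau_0$ is the identity of $\mathcal B_0=\mathcal A_0$; $\tau_{n+1}\colon\mathcal A_{n+1}\to\mathcal B_{n+1}$ is the quotient map that identifies $a,a'$ if and only if $\tau_n(\theta^{(n)}(a))=\tau_n(\theta^{(n)}(a'))$; and $\widehat\theta^{(n)}\colon\mathcal B_{n+1}\to\mathcal B_n^+$ is given by $\widehat\theta^{(n)}(\tau_{n+1}(a))=\tau_n(\theta^{(n)}(a))$. * For $0\le j<p_n/p_m$ let $(\theta^{[m,n)})_j\colon\mathcal A_n\to\mathcal A_m$ be the column sending $a$ to the $j$-th letter of $\theta^{[m,n)}(a)$, and put $$c(\boldsymbol\theta,m)=\inf\Bigl\{\bigl|(\theta^{[m,n)})_j(\mathcal A_n)\bigr| : n>m,\ 0\le j<\tfrac{p_n}{p_m}\Bigr\},\qquad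 \bar c(\boldsymbol\theta)=\lim_{m\to\infty}c(\boldsymbol\theta,m)=\sup_{m}c(\boldsymbol\theta,m).$$ **Theorem.** 1. Suppose that $\boldsymbol\theta$ is injective and quasi-recognizable, and let $\pi$ be a tiling factor map. Then some fibre $\pi^{-1}(z)$, $z\in\mathbb Z_{(q_n)}$, has exactly $\bar c(\boldsymbol\theta)$ elements, and no fibre has exactly $k$ elements for any $k<\bar c(\boldsymbol\theta)$. 2. Suppose that $\boldsymbol\theta$ is torsion-free (not necessarily injective). Then $\boldsymbol\theta$ is quasi-recognizable, and for every tiling factor map $\pi$ some fibre has exactly $\bar c(\widehat{\boldsymbol\theta})$ elements, and no fibre has exactly $k$ elements for any $k<\bar c(\widehat{\boldsymbol\theta})$. -/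

import Mathlib

universe u

/-! ### Odometers -/

/-- `p_n = q_0 q_1 ⋯ q_{n-1}`, with `p_0 = 1`. -/
def lengthProd (q : ℕ → ℕ) (n : ℕ) : ℕ := ∏ i ∈ Finset.range n, q i

theorem lengthProd_dvd_succ (q : ℕ → ℕ) (n : ℕ) : lengthProd q n ∣ lengthProd q (n + 1) := by
  unfold lengthProd
  rw [Finset.prod_range_succ]
  exact dvd_mul_right _ _

/-- The odometer group `ℤ_(q_n)`, as the inverse limit of the cyclic groups `ℤ / p_n ℤ`. It
carries the subspace topology of the product of the (discrete) groups `ZMod (p_n)`. -/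
def Odometer (q : ℕ → ℕ) : AddSubgroup (∀ n, ZMod (lengthProd q n)) where
  carrier := {z | ∀ n, ZMod.castHom (lengthProd_dvd_succ q n) (ZMod (lengthProd q n)) (z (n + 1))
    = z n}
  zero_mem' := by intro n; simp
  add_mem' := by
    intro a b ha hb n
    simp only [Pi.add_apply, map_add]
    rw [ha n, hb n]
  neg_mem' := by
    intro a ha n
    simp only [Pi.neg_apply, map_neg]
    rw [ha n]

/-- The element `1` of the odometer. -/
def Odometer.one (q : ℕ → ℕ) : Odometer q := ⟨fun _ => 1, fun _ => map_one _⟩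

/-! ### Two-sided shifts -/

/-- The left shift on two-sided sequences. -/
def shift {A : Type u} (x : ℤ → A) : ℤ → A := fun i => x (i + 1)

/-- The word `x_k x_{k+1} ⋯ x_{k+l-1}` of a two-sided sequence. -/
def subword {A : Type u} (x : ℤ → A) (k : ℤ) (l : ℕ) : List A :=
  (List.range l).map fun i => x (k + i)

/-- A set of two-sided sequences is a minimal shift if it is closed, shift-invariant and nonempty,
and has no closed forward-shift-invariant subset other than `∅` and itself. -/
def IsMinimalShift {A : Type u} [TopologicalSpace A] (X : Set (ℤ → A)) : Prop :=
  IsClosed X ∧ shift '' X = X ∧ X.Nonempty ∧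
    ∀ Y ⊆ X, IsClosed Y → Set.MapsTo shift Y Y → Y = ∅ ∨ Y = X

/-- No point of `X` is shift-periodic. -/
def IsAperiodicShift {A : Type u} (X : Set (ℤ → A)) : Prop :=
  ∀ x ∈ X, ∀ k : ℕ, 1 ≤ k → shift^[k] x ≠ x

/-! ### Directive sequences -/

/-- A directive sequence: finite alphabets `𝒜_n` and morphisms `θ^(n) : 𝒜_{n+1} → 𝒜_n⁺`, given by
the (nonempty) images of the letters. -/
structure DirectiveSequence where
  Alphabet : ℕ → Type u
  finite_alphabet : ∀ n, Finite (Alphabet n)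
  morphism : ∀ n, Alphabet (n + 1) → List (Alphabet n)
  morphism_ne_nil : ∀ n a, morphism n a ≠ []

namespace DirectiveSequence

/-- Alphabets are discrete. -/
instance alphabetTopology (θ : DirectiveSequence.{u}) (n : ℕ) :
    TopologicalSpace (θ.Alphabet n) := ⊥

/-- `θ.HasLengthSequence q`: every `θ^(n)` is a morphism of constant length `q n`. -/
def HasLengthSequence (θ : DirectiveSequence.{u}) (q : ℕ → ℕ) : Prop :=
  ∀ n a, (θ.morphism n a).length = q n

/-- The cardinalities of the alphabets are bounded. -/
def BoundedAlphabets (θ : DirectiveSequence.{u}) : Prop :=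
  ∃ B : ℕ, ∀ n, Nat.card (θ.Alphabet n) ≤ B

/-- Every morphism is injective on letters. -/
def IsInjective (θ : DirectiveSequence.{u}) : Prop :=
  ∀ n, Function.Injective (θ.morphism n)

/-- `θ.comp m k a` is the word `θ^[m,m+k)(a)`, where
`θ^[m,m+k) = θ^(m) ∘ θ^(m+1) ∘ ⋯ ∘ θ^(m+k-1)`. -/
def comp (θ : DirectiveSequence.{u}) (m : ℕ) :
    (k : ℕ) → θ.Alphabet (m + k) → List (θ.Alphabet m)
  | 0, a => [a]
  | k + 1, a => (θ.morphism (m + k) a).flatMap (θ.comp m k)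

/-- The words over `𝒜_n` that are subwords of `θ^[n,N)(a)` for some `N > n` and `a ∈ 𝒜_N`. -/
def language (θ : DirectiveSequence.{u}) (n : ℕ) : Set (List (θ.Alphabet n)) :=
  {w | ∃ k : ℕ, 1 ≤ k ∧ ∃ a : θ.Alphabet (n + k), w <:+: θ.comp n k a}

/-- The shift `X^(n)`: the two-sided sequences over `𝒜_n` all of whose subwords belong to the
language of level `n`. The `S`-adic shift generated by `θ` is `θ.X 0`. -/
def X (θ : DirectiveSequence.{u}) (n : ℕ) : Set (ℤ → θ.Alphabet n) :=
  {x | ∀ (k : ℤ) (l : ℕ), subword x k l ∈ θ.language n}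

theorem shift_mem (θ : DirectiveSequence.{u}) (n : ℕ) {x : ℤ → θ.Alphabet n} (hx : x ∈ θ.X n) :
    shift x ∈ θ.X n := by
  intro k l
  have h : subword (shift x) k l = subword x (k + 1) l := by
    unfold subword shift
    refine List.map_congr_left fun i _ => ?_
    congr 1
    ring
  rw [h]
  exact hx _ _

/-- The left shift as a self-map of `X^(n)`. -/
def shiftMap (θ : DirectiveSequence.{u}) (n : ℕ) (x : θ.X n) : θ.X n :=
  ⟨shift x.1, θ.shift_mem n x.2⟩

/-- A tiling factor map is a factor map (continuous, surjective, equivariant)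
`(X_θ, σ) → (ℤ_(q_n), +1)`. -/
structure IsTilingFactorMap (θ : DirectiveSequence.{u}) (q : ℕ → ℕ) (π : θ.X 0 → Odometer q) :
    Prop where
  continuous : Continuous π
  surjective : Function.Surjective π
  equivariant : ∀ x, π (θ.shiftMap 0 x) = π x + Odometer.one q

/-- Quasi-recognizability of a directive sequence with length sequence `q`. -/
structure IsQuasiRecognizable (θ : DirectiveSequence.{u}) (q : ℕ → ℕ) : Prop where
  hasLength : θ.HasLengthSequence q
  minimal : ∀ n, IsMinimalShift (θ.X n)
  exists_factor : ∃ π : θ.X 0 → Odometer q, θ.IsTilingFactorMap q π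

/-- Torsion-freeness of a directive sequence with length sequence `q`. -/
structure IsTorsionFree (θ : DirectiveSequence.{u}) (q : ℕ → ℕ) : Prop where
  hasLength : θ.HasLengthSequence q
  one_lt_infinitely_often : ∀ N, ∃ n ≥ N, 1 < q n
  minimal : ∀ n, IsMinimalShift (θ.X n)
  aperiodic : IsAperiodicShift (θ.X 0)
  prime_dvd : ∀ p : ℕ, p.Prime → (∃ k, p ∣ q k) → ∀ N, ∃ n ≥ N, p ∣ q n

/-! ### The injectivisation -/

/-- The equivalence relations of the injectivisation, level by level. At level `0` it is equality.
If `τ_n : 𝒜_n → ℬ_n` is the quotient map of level `n`, then letters `a, a'` of `𝒜_{n+1}` are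
identified if and only if `τ_n (θ^(n)(a)) = τ_n (θ^(n)(a'))`. -/
def identify (θ : DirectiveSequence.{u}) : (n : ℕ) → Setoid (θ.Alphabet n)
  | 0 => ⊥
  | n + 1 => Setoid.ker fun a => (θ.morphism n a).map (Quotient.mk (θ.identify n))

/-- The injectivisation: its alphabets are `ℬ_n = 𝒜_n / ∼`, and its morphisms send the class
`τ_{n+1}(a)` to `τ_n (θ^(n)(a))`. -/
def injectivisation (θ : DirectiveSequence.{u}) : DirectiveSequence.{u} where
  Alphabet n := Quotient (θ.identify n)
  finite_alphabet n :=
    haveI := θ.finite_alphabet n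
    inferInstance
  morphism n := Quotient.lift (s := θ.identify (n + 1))
    (fun a => (θ.morphism n a).map (Quotient.mk (θ.identify n))) fun _ _ h => h
  morphism_ne_nil n a := by
    induction a using Quotient.inductionOn with
    | h a => exact fun h => θ.morphism_ne_nil n a (List.map_eq_nil_iff.mp h)

/-! ### Column numbers -/

/-- The column of index `j` of `θ^[m,m+k)`. For `j` below the length of that morphism its value at
`a` is `some` of the letter with index `j` of the word `θ^[m,m+k)(a)`. -/
def column (θ : DirectiveSequence.{u}) (m k j : ℕ) (a : θ.Alphabet (m + k)) :
    Option (θ.Alphabet m) :=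
  (θ.comp m k a)[j]?

/-- `c(θ,m)`: the least cardinality of the image of a column of `θ^[m,n)`, over all `n = m + k > m`.
The length of `θ^[m,m+k)` is `p_{m+k} / p_m = q_m q_{m+1} ⋯ q_{m+k-1}`. -/
noncomputable def minColumnCard (θ : DirectiveSequence.{u}) (q : ℕ → ℕ) (m : ℕ) : ℕ :=
  sInf {c | ∃ k : ℕ, 1 ≤ k ∧ ∃ j < ∏ i ∈ Finset.range k, q (m + i),
    c = (Set.range (θ.column m k j)).ncard}

/-- The naïve column number: the limit, that is the supremum, of the nondecreasing sequence
`c(θ,m)`, as an element of `ℕ∞`. -/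
noncomputable def naiveColumnNumber (θ : DirectiveSequence.{u}) (q : ℕ → ℕ) : ℕ∞ :=
  ⨆ m, (θ.minColumnCard q m : ℕ∞)

end DirectiveSequence

section

open Set Filter Topology

/-! ### Translations and block lengths -/

/-! For `m ≤ N` the tiles `σ^k θ^[m,N)(X^(N))` are compact, cover `X^(m)` and depend only on `k`
modulo `p_N / p_m`. By minimality of `X^(N)`, a continuous equivariant map to `ℤ/p_N` is constant on
each level-`N` tile of `X_θ`. Given a tiling factor map, these tiles are therefore the level sets of
its `N`-th coordinate (`coord_eq_iff`), and its fibres are nested intersections of tiles.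

A small fibre (`exists_fibre_encard_le`): compose columns of minimal image, placed ever farther from
the ends of the blocks. In the resulting fibre a window of radius `i` is determined by one letter of
a column with at most `c(θ, M_i)` values, so the fibre has at most `c̄(θ)` points.

Every fibre is large (`naiveColumnNumber_le_fibre_encard`): at level `m`, the letters at the origin
along the nested tiles of a fibre form decreasing finite sets of size at least `c(θ,m)`. Compactness
lifts each letter of the eventual set to a point lying in all these tiles, and injectivity of
`θ^[0,m)` keeps the lifts distinct in `X_θ`.

In the torsion-free case the factor map has to be built. There are `d` level-`N` tiles, with `p_N =
dM`. If `M ≥ |𝒜_N|`, then recoding a point by blocks of length `d` gives at most `M` words of length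
`M`, and Morse–Hedlund contradicts aperiodicity (`blockLength_lt_mul_card`). Hence `M` is bounded.
Choosing `N` with `p_N` divisible by a high power of `p_n` forces `p_n ∣ d`, so the cyclic factor
`ℤ/d` maps onto `ℤ/p_n`. Finally, `τ_0` is bijective, so the injectivisation has the same shift up
to relabelling and the injective case applies to it. -/

/-- Translation of a two-sided sequence by an integer. -/
def shiftBy {A : Type u} (k : ℤ) (x : ℤ → A) : ℤ → A := fun i => x (i + k)

theorem shiftBy_zero {A : Type u} (x : ℤ → A) : shiftBy 0 x = x := by
  funext i; simp [shiftBy]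

theorem shiftBy_shiftBy {A : Type u} (k l : ℤ) (x : ℤ → A) :
    shiftBy k (shiftBy l x) = shiftBy (k + l) x := by
  funext i; simp [shiftBy, add_assoc]

theorem shift_eq_shiftBy {A : Type u} : (shift : (ℤ → A) → ℤ → A) = shiftBy 1 := rfl

theorem shift_iterate {A : Type u} (k : ℕ) (x : ℤ → A) : shift^[k] x = shiftBy k x := by
  induction k with
  | zero => simp [shiftBy_zero]
  | succ k ih =>
    rw [Function.iterate_succ_apply', ih, shift_eq_shiftBy, shiftBy_shiftBy]
    push_cast
    rw [add_comm]

theorem continuous_shiftBy {A : Type u} [TopologicalSpace A] (k : ℤ) :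
    Continuous (shiftBy k : (ℤ → A) → ℤ → A) :=
  continuous_pi fun i => continuous_apply (i + k)

/-- The length `q_m q_{m+1} ⋯ q_{N-1}` of the words `θ^[m,N)(a)`. -/
def blockLength (q : ℕ → ℕ) (m N : ℕ) : ℕ := ∏ i ∈ Finset.Ico m N, q i

theorem blockLength_self (q : ℕ → ℕ) (m : ℕ) : blockLength q m m = 1 := by simp [blockLength]

theorem blockLength_succ (q : ℕ → ℕ) {m N : ℕ} (h : m ≤ N) :
    blockLength q m (N + 1) = blockLength q m N * q N := Finset.prod_Ico_succ_top h q

theorem blockLength_mul (q : ℕ → ℕ) {m n N : ℕ} (h : m ≤ n) (h' : n ≤ N) :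
    blockLength q m n * blockLength q n N = blockLength q m N :=
  Finset.prod_Ico_consecutive q h h'

theorem blockLength_zero_left (q : ℕ → ℕ) (N : ℕ) : blockLength q 0 N = lengthProd q N := by
  rw [blockLength, lengthProd, Finset.range_eq_Ico]

theorem blockLength_add (q : ℕ → ℕ) (m k : ℕ) :
    blockLength q m (m + k) = ∏ i ∈ Finset.range k, q (m + i) := by
  rw [blockLength, Finset.prod_Ico_eq_prod_range, Nat.add_sub_cancel_left]

theorem blockLength_pos {q : ℕ → ℕ} (hpos : ∀ n, 0 < q n) (m N : ℕ) : 0 < blockLength q m N :=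
  Finset.prod_pos fun i _ => hpos i

theorem subword_eq_map {A : Type u} (x : ℤ → A) (k : ℤ) (l : ℕ) :
    subword x k l = (List.range l).map fun i : ℕ => x (k + i) := by
  change List.map _ (List.flatMap (fun a : ℕ => [(a : ℤ)]) (List.range l)) = _
  rw [← List.map_eq_flatMap, List.map_map]
  rfl

/-- Compactness of `A^ℤ`, in the finitary form used for all limits of finite words: `x` is a cluster
point of `u`. -/
theorem exists_eq_on_windows {A : Type u} [Finite A] (u : ℕ → ℤ → A) :
    ∃ x : ℤ → A, ∀ R L : ℕ, ∃ l ≥ L, ∀ i : ℤ, -R ≤ i → i ≤ R → u l i = x i := by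
  let _ : TopologicalSpace A := ⊥
  have : DiscreteTopology A := ⟨rfl⟩
  obtain ⟨x, hx⟩ := exists_clusterPt_of_compactSpace (map u atTop)
  refine ⟨x, fun R L => ?_⟩
  have hU : {y : ℤ → A | ∀ i ∈ Set.Icc (-R : ℤ) R, y i = x i} ∈ 𝓝 x := by
    have := set_pi_mem_nhds (Set.finite_Icc (-R : ℤ) R)
      (fun i _ => (isOpen_discrete {x i}).mem_nhds rfl)
    filter_upwards [this] with y hy i hi using hy i hi
  have := (mapClusterPt_iff_frequently.1 hx) _ hU
  obtain ⟨l, hl, h⟩ := (frequently_atTop.1 this) L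
  exact ⟨l, hl, fun i h1 h2 => h i ⟨h1, h2⟩⟩

theorem List.range_mul_map {B : Type u} (P k : ℕ) (f : ℕ → B) :
    (List.range (P * k)).map f =
      (List.range k).flatMap fun j => (List.range P).map fun i => f (j * P + i) := by
  induction k with
  | zero => simp
  | succ k ih =>
    rw [Nat.mul_succ, List.range_add, List.map_append, ih, List.range_succ, List.flatMap_append,
      List.map_map]
    simp [Function.comp_def, mul_comm]

namespace DirectiveSequence

instance (θ : DirectiveSequence.{u}) (n : ℕ) : DiscreteTopology (θ.Alphabet n) := ⟨rfl⟩

instance (θ : DirectiveSequence.{u}) (n : ℕ) : Finite (θ.Alphabet n) := θ.finite_alphabet n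

variable {θ : DirectiveSequence.{u}} {q : ℕ → ℕ}

/-! ### Substitution on two-sided sequences -/

variable (θ q) in
/-- The image of a two-sided sequence under `θ^(n)`, a morphism of length `q n`. -/
def expand (n : ℕ) (y : ℤ → θ.Alphabet (n + 1)) : ℤ → θ.Alphabet n := fun i =>
  -- When the images have length `q n > 0`, the index is in range and the default is never taken;
  -- the head serves as default without assuming the alphabet inhabited.
  (θ.morphism n (y (i / q n))).getD (i % q n).toNat
    ((θ.morphism n (y (i / q n))).head (θ.morphism_ne_nil n _))

variable (θ q) in
/-- The image of a two-sided sequence under `θ^[m,N)`. -/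
def expandTo {m N : ℕ} (h : m ≤ N) : (ℤ → θ.Alphabet N) → ℤ → θ.Alphabet m :=
  Nat.leRec (motive := fun N _ => (ℤ → θ.Alphabet N) → ℤ → θ.Alphabet m) id
    (fun k _ f y => f (θ.expand q k y)) h

theorem expandTo_self (m : ℕ) (y : ℤ → θ.Alphabet m) : θ.expandTo q (le_refl m) y = y := by
  rw [expandTo, Nat.leRec_self]; rfl

theorem expandTo_succ {m N : ℕ} (h : m ≤ N) (y : ℤ → θ.Alphabet (N + 1)) :
    θ.expandTo q (h.trans N.le_succ) y = θ.expandTo q h (θ.expand q N y) := by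
  rw [expandTo, Nat.leRec_succ _ _ h]; rfl

theorem expandTo_expandTo {m n N : ℕ} (h : m ≤ n) (h' : n ≤ N) (y : ℤ → θ.Alphabet N) :
    θ.expandTo q h (θ.expandTo q h' y) = θ.expandTo q (h.trans h') y := by
  induction N, h' using Nat.le_induction with
  | base => rw [expandTo_self]
  | succ N h' ih => rw [expandTo_succ h', ih, expandTo_succ (h.trans h')]

theorem expandTo_one (n : ℕ) (y : ℤ → θ.Alphabet (n + 1)) :
    θ.expandTo q n.le_succ y = θ.expand q n y := by
  rw [expandTo_succ (le_refl n), expandTo_self]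

theorem expand_congr {n : ℕ} {y y' : ℤ → θ.Alphabet (n + 1)} {i i' : ℤ}
    (h : y (i / q n) = y' (i' / q n)) (h' : i % q n = i' % q n) :
    θ.expand q n y i = θ.expand q n y' i' := by
  simp only [expand, h, h']

theorem expand_shiftBy (hpos : ∀ n, 0 < q n) (n : ℕ) (k : ℤ) (y : ℤ → θ.Alphabet (n + 1)) :
    θ.expand q n (shiftBy k y) = shiftBy (k * q n) (θ.expand q n y) := by
  have := (hpos n).ne'
  funext i
  refine expand_congr ?_ (by simp)
  rw [Int.add_mul_ediv_right _ _ (by exact_mod_cast this)]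
  rfl

theorem expandTo_shiftBy (hpos : ∀ n, 0 < q n) {m N : ℕ} (h : m ≤ N) (k : ℤ)
    (y : ℤ → θ.Alphabet N) : θ.expandTo q h (shiftBy k y) =
      shiftBy (k * blockLength q m N) (θ.expandTo q h y) := by
  induction N, h using Nat.le_induction generalizing k with
  | base => simp [expandTo_self, blockLength_self]
  | succ N h ih =>
    rw [expandTo_succ h, expandTo_succ h, expand_shiftBy hpos, ih, blockLength_succ q h]
    push_cast
    congr 1
    ring

theorem expandTo_add_mul (hpos : ∀ n, 0 < q n) {m N : ℕ} (h : m ≤ N) (y : ℤ → θ.Alphabet N)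
    (i k : ℤ) : θ.expandTo q h y (i + k * blockLength q m N) =
      θ.expandTo q h (shiftBy k y) i := by
  rw [expandTo_shiftBy hpos]; rfl

theorem expandTo_congr {m N : ℕ} (h : m ≤ N) {y y' : ℤ → θ.Alphabet N} {i : ℤ}
    (hy : y (i / blockLength q m N) = y' (i / blockLength q m N)) :
    θ.expandTo q h y i = θ.expandTo q h y' i := by
  induction N, h using Nat.le_induction with
  | base => simpa [expandTo_self, blockLength_self] using hy
  | succ N h ih =>
    rw [expandTo_succ h, expandTo_succ h]
    refine ih (expand_congr ?_ rfl)
    rw [blockLength_succ q h] at hy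
    push_cast at hy
    rwa [← Int.ediv_ediv_of_nonneg (by positivity)] at hy

/-- Constant sequences stand for letters throughout: the word `θ^[m,N)(a)` is the image of the
constant sequence `a`, read on `[0, blockLength q m N)`. -/
theorem expandTo_eq_const {m N : ℕ} (h : m ≤ N) (y : ℤ → θ.Alphabet N) (i : ℤ) :
    θ.expandTo q h y i = θ.expandTo q h (fun _ => y (i / blockLength q m N)) i :=
  expandTo_congr h rfl

theorem continuous_expandTo {m N : ℕ} (h : m ≤ N) : Continuous (θ.expandTo q h) := by
  refine continuous_pi fun i => ?_
  have : (fun y => θ.expandTo q h y i) = (fun a => θ.expandTo q h (fun _ => a) i) ∘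
      fun y => y (i / blockLength q m N) := funext fun y => expandTo_eq_const h y i
  rw [this]
  exact continuous_of_discreteTopology.comp (continuous_apply _)

theorem morphism_eq (hq : θ.HasLengthSequence q) (n : ℕ) (y : ℤ → θ.Alphabet (n + 1)) (j : ℤ) :
    θ.morphism n (y j) = (List.range (q n)).map fun i : ℕ => θ.expand q n y (j * q n + i) := by
  refine List.ext_getElem (by simp [hq n]) fun t h1 h2 => ?_
  rw [hq n] at h1
  have h3 : ((j * q n + t) / q n : ℤ) = j := by
    rw [Int.add_comm, Int.add_mul_ediv_right _ _ (by omega),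
      Int.ediv_eq_zero_of_lt (by omega) (by omega), zero_add]
  have h4 : ((j * q n + t) % q n : ℤ) = t := by
    rw [Int.add_comm, Int.add_mul_emod_self_right, Int.emod_eq_of_lt (by omega) (by omega)]
  simp only [List.getElem_map, List.getElem_range, expand, h3, h4, Int.toNat_natCast]
  rw [List.getD_eq_getElem _ _ (by rw [hq n]; exact h1)]

theorem expandTo_injective (hq : θ.HasLengthSequence q) (hinj : θ.IsInjective) {m N : ℕ}
    (h : m ≤ N) : Function.Injective (θ.expandTo q h) := by
  induction N, h using Nat.le_induction with
  | base => intro y y' hy; simpa [expandTo_self] using hy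
  | succ N h ih =>
    intro y y' hy
    rw [expandTo_succ h, expandTo_succ h] at hy
    have := ih hy
    funext j
    apply hinj N
    rw [morphism_eq hq, morphism_eq hq, this]

theorem comp_eq (hq : θ.HasLengthSequence q) (hpos : ∀ n, 0 < q n) (m k : ℕ)
    (a : θ.Alphabet (m + k)) : θ.comp m k a = (List.range (blockLength q m (m + k))).map
      fun i : ℕ => θ.expandTo q (Nat.le_add_right m k) (fun _ => a) i := by
  induction k with
  | zero => simp [comp, blockLength_self, expandTo_self]
  | succ k ih =>
    have hm := morphism_eq hq (m + k) (fun _ => a) 0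
    have hb := blockLength_succ q (Nat.le_add_right m k)
    change _ = (List.range (blockLength q m (m + k + 1))).map _
    rw [comp, hm, hb, List.range_mul_map, List.flatMap_map]
    refine List.flatMap_congr fun j _ => ?_
    rw [ih]
    refine List.map_congr_left fun i hi => ?_
    rw [List.mem_range] at hi
    rw [expandTo_succ (Nat.le_add_right m k)]
    have : (fun _ => θ.expand q (m + k) (fun _ => a) (0 * (q (m + k) : ℤ) + j)) =
      fun _ : ℤ => shiftBy j (θ.expand q (m + k) (fun _ => a)) 0 := by simp [shiftBy]
    rw [this]
    have h0 : (i : ℤ) / blockLength q m (m + k) = 0 :=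
      Int.ediv_eq_zero_of_lt (by omega) (by omega)
    have := expandTo_eq_const (q := q) (Nat.le_add_right m k)
      (shiftBy j (θ.expand q (m + k) (fun _ => a))) i
    rw [h0] at this
    rw [← this, expandTo_shiftBy hpos, shiftBy]
    congr 1
    push_cast
    ring

/-! ### The shifts `X^(n)` in terms of windows -/

variable (θ q) in
/-- The window `[u, v)` of `x` is a subword of some `θ^[n,N)(a)`. -/
def IsWindow (n : ℕ) (x : ℤ → θ.Alphabet n) (u v : ℤ) : Prop :=
  ∃ (N : ℕ) (h : n < N) (a : θ.Alphabet N) (s : ℤ), 0 ≤ u + s ∧ v + s ≤ blockLength q n N ∧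
    ∀ i, u ≤ i → i < v → x i = θ.expandTo q h.le (fun _ => a) (i + s)

theorem subword_mem_language_iff (hq : θ.HasLengthSequence q) (hpos : ∀ n, 0 < q n) (n : ℕ)
    (x : ℤ → θ.Alphabet n) (k : ℤ) (l : ℕ) :
    subword x k l ∈ θ.language n ↔ θ.IsWindow q n x k (k + l) := by
  constructor
  · rintro ⟨K, hK, a, hw⟩
    rw [comp_eq hq hpos, List.infix_iff_getElem?] at hw
    obtain ⟨s, hs, hw⟩ := hw
    simp only [subword_eq_map, List.length_map, List.length_range] at hs hw
    refine ⟨n + K, by omega, a, s - k, by omega, by omega, fun i h1 h2 => ?_⟩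
    obtain ⟨t, rfl⟩ : ∃ t : ℕ, i = k + t := ⟨(i - k).toNat, by omega⟩
    have := hw t (by omega)
    rw [List.getElem?_eq_getElem (by simp; omega)] at this
    simp only [List.getElem_map, List.getElem_range, Option.some.injEq] at this
    rw [← this]
    congr 1
    push_cast
    ring
  · rintro ⟨N, h, a, s, h1, h2, hw⟩
    obtain ⟨K, rfl⟩ := Nat.exists_eq_add_of_lt h
    refine ⟨K + 1, by omega, a, ?_⟩
    rw [comp_eq hq hpos, List.infix_iff_getElem?]
    simp only [subword_eq_map, List.length_map, List.length_range]
    refine ⟨(k + s).toNat, ?_, fun i hi => ?_⟩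
    · change _ ≤ blockLength q n (n + K + 1)
      omega
    · have hlt : i + (k + s).toNat < blockLength q n (n + K + 1) := by omega
      rw [List.getElem?_eq_getElem (by rw [List.length_map, List.length_range]; exact hlt)]
      simp only [List.getElem_map, List.getElem_range, Option.some.injEq]
      rw [hw _ (by omega) (by omega)]
      congr 1
      push_cast
      omega

theorem IsWindow.mono {n : ℕ} {x : ℤ → θ.Alphabet n} {u v u' v' : ℤ} (h : θ.IsWindow q n x u v)
    (hu : u ≤ u') (hv : v' ≤ v) : θ.IsWindow q n x u' v' := by
  obtain ⟨N, hN, a, s, h1, h2, h3⟩ := h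
  exact ⟨N, hN, a, s, by omega, by omega, fun i hi hi' => h3 i (by omega) (by omega)⟩

theorem IsWindow.congr {n : ℕ} {x y : ℤ → θ.Alphabet n} {u v : ℤ} (h : θ.IsWindow q n x u v)
    (hxy : ∀ i, u ≤ i → i < v → x i = y i) : θ.IsWindow q n y u v := by
  obtain ⟨N, hN, a, s, h1, h2, h3⟩ := h
  exact ⟨N, hN, a, s, h1, h2, fun i hi hi' => (hxy i hi hi').symm.trans (h3 i hi hi')⟩

theorem IsWindow.shiftBy {n : ℕ} {x : ℤ → θ.Alphabet n} {u v : ℤ} (h : θ.IsWindow q n x u v)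
    (k : ℤ) : θ.IsWindow q n (shiftBy k x) (u - k) (v - k) := by
  obtain ⟨N, hN, a, s, h1, h2, h3⟩ := h
  refine ⟨N, hN, a, s + k, by omega, by omega, fun i hi hi' => ?_⟩
  rw [_root_.shiftBy, h3 _ (by omega) (by omega)]
  congr 1
  ring

theorem mem_X_iff (hq : θ.HasLengthSequence q) (hpos : ∀ n, 0 < q n) {n : ℕ}
    {x : ℤ → θ.Alphabet n} : x ∈ θ.X n ↔ ∀ R : ℕ, θ.IsWindow q n x (-R) R := by
  constructor
  · intro hx R
    exact ((subword_mem_language_iff hq hpos n x _ _).1 (hx (-R) (2 * R))).mono le_rfl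
      (by push_cast; omega)
  · intro hx k l
    rw [subword_mem_language_iff hq hpos]
    exact (hx (k.natAbs + l)).mono (by omega) (by omega)

theorem shiftBy_mem_X {n : ℕ} {x : ℤ → θ.Alphabet n} (hx : x ∈ θ.X n) (k : ℤ) :
    shiftBy k x ∈ θ.X n := by
  intro j l
  have : subword (shiftBy k x) j l = subword x (j + k) l := by
    rw [subword_eq_map, subword_eq_map]
    refine List.map_congr_left fun i _ => ?_
    simp only [shiftBy]
    congr 1
    ring
  rw [this]
  exact hx _ _

theorem isClosed_X (n : ℕ) : IsClosed (θ.X n) := by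
  have : θ.X n = ⋂ (k : ℤ), ⋂ (l : ℕ), (fun x => subword x k l) ⁻¹' θ.language n := by
    ext x; simp [X]
  rw [this]
  refine isClosed_iInter fun k => isClosed_iInter fun l => ?_
  let _ : TopologicalSpace (List (θ.Alphabet n)) := ⊥
  have : DiscreteTopology (List (θ.Alphabet n)) := ⟨rfl⟩
  refine (isClosed_discrete _).preimage ?_
  have : (fun x : ℤ → θ.Alphabet n => subword x k l) =
      (fun w : Fin l → θ.Alphabet n => List.ofFn w) ∘ fun x i => x (k + i) := by
    funext x
    rw [subword_eq_map]
    exact List.ext_getElem (by simp) fun t h1 h2 => by simp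
  rw [this]
  exact continuous_of_discreteTopology.comp (continuous_pi fun i => continuous_apply _)

theorem exists_mem_X_eq_on_windows (hq : θ.HasLengthSequence q) (hpos : ∀ n, 0 < q n) {n : ℕ}
    (u : ℕ → ℤ → θ.Alphabet n) (hu : ∀ R : ℕ, θ.IsWindow q n (u R) (-R) R) :
    ∃ y ∈ θ.X n, ∀ R L : ℕ, ∃ l ≥ L, ∀ i : ℤ, -R ≤ i → i ≤ R → u l i = y i := by
  obtain ⟨y, hy⟩ := exists_eq_on_windows u
  refine ⟨y, (mem_X_iff hq hpos).2 fun R => ?_, hy⟩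
  obtain ⟨l, hl, h⟩ := hy R R
  exact ((hu l).mono (by omega) (by omega)).congr fun i h1 h2 => h i h1 h2.le

theorem exists_blockLength_gt (hq : θ.HasLengthSequence q) (hpos : ∀ n, 0 < q n) {n : ℕ}
    (hne : (θ.X n).Nonempty) (R : ℕ) : ∃ N > n, R ≤ blockLength q n N := by
  obtain ⟨x, hx⟩ := hne
  obtain ⟨N, hN, a, s, h1, h2, -⟩ := (mem_X_iff hq hpos).1 hx R
  exact ⟨N, hN, by omega⟩

theorem length_pos (hq : θ.HasLengthSequence q) (hne : ∀ n, (θ.X n).Nonempty) (n : ℕ) :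
    0 < q n := by
  obtain ⟨y, -⟩ := hne (n + 1)
  rw [← hq n (y 0)]
  exact List.length_pos_of_ne_nil (θ.morphism_ne_nil n _)

theorem expand_mem_X (hq : θ.HasLengthSequence q) (hpos : ∀ n, 0 < q n) {n : ℕ}
    {y : ℤ → θ.Alphabet (n + 1)} (hy : y ∈ θ.X (n + 1)) : θ.expand q n y ∈ θ.X n := by
  rw [mem_X_iff hq hpos]
  intro R
  obtain ⟨N, hN, a, s, h1, h2, h3⟩ := (mem_X_iff hq hpos).1 hy (R + 1)
  have hb : (blockLength q n N : ℤ) = q n * blockLength q (n + 1) N := by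
    rw [← blockLength_mul q (n.le_succ) hN.le, blockLength_succ q (le_refl n), blockLength_self]
    push_cast
    ring
  have hqn : (1 : ℤ) ≤ q n := by exact_mod_cast hpos n
  push_cast at h1 h2 h3
  refine ⟨N, by omega, a, s * q n, by nlinarith, by rw [hb]; nlinarith, fun i hi hi' => ?_⟩
  rw [← expandTo_expandTo n.le_succ hN.le, expandTo_one]
  have h4 : (i + s * q n) / q n = i / q n + s := Int.add_mul_ediv_right _ _ (by omega)
  refine expand_congr ?_ (by simp)
  rw [h4]
  refine h3 _ ?_ ?_
  · rw [Int.le_ediv_iff_mul_le (by omega)]; nlinarith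
  · rw [Int.ediv_lt_iff_lt_mul (by omega)]; nlinarith

theorem expandTo_mem_X (hq : θ.HasLengthSequence q) (hpos : ∀ n, 0 < q n) {m N : ℕ} (h : m ≤ N)
    {y : ℤ → θ.Alphabet N} (hy : y ∈ θ.X N) : θ.expandTo q h y ∈ θ.X m := by
  induction N, h using Nat.le_induction with
  | base => rwa [expandTo_self]
  | succ N h ih => rw [expandTo_succ h]; exact ih (expand_mem_X hq hpos hy)

/-- Each finite window of `x` lies in some `θ^[n,N)(a)` and so desubstitutes, with a cutting offset
below `q n`; a limit of the desubstituted windows works for all of `x`. -/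
theorem exists_eq_shiftBy_expand (hq : θ.HasLengthSequence q) (hpos : ∀ n, 0 < q n) {n : ℕ}
    {x : ℤ → θ.Alphabet n} (hx : x ∈ θ.X n) :
    ∃ y ∈ θ.X (n + 1), ∃ k : ℤ, x = shiftBy k (θ.expand q n y) := by
  have hqn : (1 : ℤ) ≤ q n := by exact_mod_cast hpos n
  have key : ∀ R : ℕ, ∃ (v : ℤ → θ.Alphabet (n + 1)) (k : ℕ), k < q n ∧
      θ.IsWindow q (n + 1) v (-R) R ∧
      ∀ i : ℤ, -R ≤ i → i ≤ R → x i = shiftBy k (θ.expand q n v) i := by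
    intro R
    -- The extra `q n` on each side absorbs the cutting offset; the window is also too long for a
    -- single `θ^(n)(a)`, whence `N > n + 1`.
    obtain ⟨N, hN, a, s, h1, h2, h3⟩ := (mem_X_iff hq hpos).1 hx ((R + 1) * q n)
    have hN' : n + 1 < N := by
      refine lt_of_le_of_ne hN fun h => ?_
      subst h
      rw [blockLength_succ q (le_refl n), blockLength_self] at h2
      push_cast at h1 h2
      nlinarith
    have hb : (blockLength q n N : ℤ) = q n * blockLength q (n + 1) N := by
      rw [← blockLength_mul q (n.le_succ) hN'.le, blockLength_succ q (le_refl n), blockLength_self]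
      push_cast
      ring
    have hdm := Int.emod_add_mul_ediv s (q n)
    have hlt := Int.emod_lt_of_pos s (by omega : (0 : ℤ) < q n)
    have hnn := Int.emod_nonneg s (by omega : (q n : ℤ) ≠ 0)
    push_cast at h1 h2 h3
    refine ⟨shiftBy (s / q n) (θ.expandTo q hN'.le fun _ => a), (s % q n).toNat, by omega,
      ⟨N, hN', a, s / q n, ?_, ?_, fun i _ _ => rfl⟩, fun i hi hi' => ?_⟩
    · have : (R : ℤ) ≤ s / q n := by
        rw [Int.le_ediv_iff_mul_le (by omega)]; nlinarith
      omega
    · rw [hb] at h2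
      by_contra! hcon
      have : (q n : ℤ) * blockLength q (n + 1) N ≤ q n * (R + s / q n) :=
        mul_le_mul_of_nonneg_left hcon.le (by omega)
      nlinarith
    · rw [h3 i (by nlinarith) (by nlinarith), expand_shiftBy hpos, shiftBy_shiftBy,
        ← expandTo_expandTo n.le_succ hN'.le, expandTo_one, shiftBy]
      congr 1
      rw [Int.toNat_of_nonneg hnn]
      linarith
  choose v k hk hv hx' using key
  -- The offset rides along as a second coordinate constant in `i`, so one extraction stabilises
  -- letters and offset together.
  obtain ⟨w, hw⟩ := exists_eq_on_windows (A := θ.Alphabet (n + 1) × ULift.{u} (Fin (q n)))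
    fun R i => (v R i, ⟨⟨k R, hk R⟩⟩)
  refine ⟨fun i => (w i).1, (mem_X_iff hq hpos).2 fun R => ?_, (w 0).2.down, ?_⟩
  · obtain ⟨l, hl, h⟩ := hw R R
    exact ((hv l).mono (by omega) (by omega)).congr
      fun i h1 h2 => congrArg Prod.fst (h i h1 h2.le)
  · funext i
    obtain ⟨l, hl, h⟩ := hw (i.natAbs + q n) (i.natAbs + q n)
    have hk0 : k l = ((w 0).2.down : ℕ) := by
      have := h 0 (by omega) (by omega)
      rw [← this]
    rw [hx' l i (by omega) (by omega), hk0]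
    refine expand_congr ?_ rfl
    have hkl := (w 0).2.down.2
    refine congrArg Prod.fst (h _ ?_ ?_)
    · rw [Int.le_ediv_iff_mul_le (by omega)]
      push_cast
      nlinarith [abs_nonneg i, neg_abs_le i]
    · refine Int.lt_add_one_iff.1 ?_
      rw [Int.ediv_lt_iff_lt_mul (by omega)]
      push_cast
      nlinarith [abs_nonneg i, le_abs_self i]

theorem exists_eq_shiftBy_expandTo (hq : θ.HasLengthSequence q) (hpos : ∀ n, 0 < q n)
    {m N : ℕ} (h : m ≤ N) {x : ℤ → θ.Alphabet m} (hx : x ∈ θ.X m) :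
    ∃ y ∈ θ.X N, ∃ k : ℤ, x = shiftBy k (θ.expandTo q h y) := by
  induction N, h using Nat.le_induction with
  | base => exact ⟨x, hx, 0, by rw [shiftBy_zero, expandTo_self]⟩
  | succ N h ih =>
    obtain ⟨y, hy, k, rfl⟩ := ih
    obtain ⟨y', hy', k', rfl⟩ := exists_eq_shiftBy_expand hq hpos hy
    refine ⟨y', hy', k + k' * blockLength q m N, ?_⟩
    rw [expandTo_shiftBy hpos, shiftBy_shiftBy, expandTo_succ h]

/-! ### Tiles -/

variable (θ q) in
/-- The set of all `σ^k (θ^[m,N) (y))` with `y ∈ X^(N)`. -/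
def tile {m N : ℕ} (h : m ≤ N) (k : ℤ) : Set (ℤ → θ.Alphabet m) :=
  (fun y => shiftBy k (θ.expandTo q h y)) '' θ.X N

theorem tile_subset_X (hq : θ.HasLengthSequence q) (hpos : ∀ n, 0 < q n) {m N : ℕ} (h : m ≤ N)
    (k : ℤ) : θ.tile q h k ⊆ θ.X m := by
  rintro _ ⟨y, hy, rfl⟩
  exact shiftBy_mem_X (expandTo_mem_X hq hpos h hy) k

theorem isCompact_tile {m N : ℕ} (h : m ≤ N) (k : ℤ) : IsCompact (θ.tile q h k) :=
  ((isClosed_X N).isCompact).image ((continuous_shiftBy k).comp (continuous_expandTo h))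

theorem isClosed_tile {m N : ℕ} (h : m ≤ N) (k : ℤ) : IsClosed (θ.tile q h k) :=
  (isCompact_tile h k).isClosed

theorem exists_mem_tile (hq : θ.HasLengthSequence q) (hpos : ∀ n, 0 < q n) {m N : ℕ} (h : m ≤ N)
    {x : ℤ → θ.Alphabet m} (hx : x ∈ θ.X m) : ∃ k, x ∈ θ.tile q h k := by
  obtain ⟨y, hy, k, rfl⟩ := exists_eq_shiftBy_expandTo hq hpos h hx
  exact ⟨k, y, hy, rfl⟩

theorem shiftBy_mem_tile {m N : ℕ} {h : m ≤ N} {k : ℤ} {x : ℤ → θ.Alphabet m}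
    (hx : x ∈ θ.tile q h k) (l : ℤ) : shiftBy l x ∈ θ.tile q h (l + k) := by
  obtain ⟨y, hy, rfl⟩ := hx
  exact ⟨y, hy, (shiftBy_shiftBy _ _ _).symm⟩

theorem exists_of_mem_tile_trans (hpos : ∀ n, 0 < q n) {m n N : ℕ}
    (h : m ≤ n) (h' : n ≤ N) {k j : ℤ} {x : ℤ → θ.Alphabet m}
    (hx : x ∈ θ.tile q (h.trans h') (k + j * blockLength q m n)) :
    ∃ w ∈ θ.tile q h' j, x = shiftBy k (θ.expandTo q h w) := by
  obtain ⟨y, hy, rfl⟩ := hx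
  refine ⟨_, ⟨y, hy, rfl⟩, ?_⟩
  simp only
  rw [expandTo_shiftBy hpos, shiftBy_shiftBy, expandTo_expandTo]

theorem tile_trans_subset (hq : θ.HasLengthSequence q) (hpos : ∀ n, 0 < q n) {m n N : ℕ}
    (h : m ≤ n) (h' : n ≤ N) (k j : ℤ) :
    θ.tile q (h.trans h') (k + j * blockLength q m n) ⊆ θ.tile q h k := by
  intro x hx
  obtain ⟨w, hw, rfl⟩ := exists_of_mem_tile_trans hpos h h' hx
  exact ⟨w, tile_subset_X hq hpos h' j hw, rfl⟩

theorem tile_add_mul (hq : θ.HasLengthSequence q) (hpos : ∀ n, 0 < q n) {m N : ℕ} (h : m ≤ N)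
    (k j : ℤ) : θ.tile q h (k + j * blockLength q m N) = θ.tile q h k := by
  have key : ∀ k j : ℤ, θ.tile q h (k + j * blockLength q m N) ⊆ θ.tile q h k :=
    fun k j => tile_trans_subset hq hpos h le_rfl k j
  refine (key k j).antisymm ?_
  have := key (k + j * blockLength q m N) (-j)
  rwa [neg_mul, add_neg_cancel_right] at this

/-! ### Equivariant maps into cyclic groups -/

theorem map_shiftBy {G : Type*} [AddGroupWithOne G] {φ : θ.X 0 → G}
    (hφ : ∀ x, φ (θ.shiftMap 0 x) = φ x + 1) (x : θ.X 0) (k : ℤ) :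
    φ ⟨shiftBy k x.1, shiftBy_mem_X x.2 k⟩ = φ x + k := by
  have hstep : ∀ k : ℤ, φ ⟨shiftBy (k + 1) x.1, shiftBy_mem_X x.2 (k + 1)⟩ =
      φ ⟨shiftBy k x.1, shiftBy_mem_X x.2 k⟩ + 1 := by
    intro k
    rw [← hφ]
    congr 1
    refine Subtype.ext ?_
    change _ = shift (shiftBy k x.1)
    rw [shift_eq_shiftBy, shiftBy_shiftBy, add_comm]
  induction k using Int.induction_on with
  | zero => simp [shiftBy_zero]
  | succ k ih => rw [hstep, ih]; push_cast; rw [add_assoc]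
  | pred k ih =>
    have := hstep (-k - 1)
    simp only [sub_add_cancel, ih] at this
    rw [← add_right_cancel_iff (a := (1 : G)), ← this]
    push_cast
    rw [add_assoc, sub_add_cancel]

/-- Shifting `y ∈ X^(N)` by one letter shifts `θ^[0,N)(y)` by `p_N`, which vanishes in `ℤ/p_N`. A
level set of `φ ∘ θ^[0,N)` is thus closed and shift-invariant, and a nonempty one is all of `X^(N)`.
-/
theorem exists_const_of_equivariant (hq : θ.HasLengthSequence q) (hpos : ∀ n, 0 < q n) {N : ℕ}
    (hmin : IsMinimalShift (θ.X N)) {φ : θ.X 0 → ZMod (lengthProd q N)} (hc : Continuous φ)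
    (hφ : ∀ x, φ (θ.shiftMap 0 x) = φ x + 1) :
    ∃ c, ∀ (k : ℤ) (x : θ.X 0), x.1 ∈ θ.tile q (Nat.zero_le N) k → φ x = c + k := by
  obtain ⟨hcl, -, ⟨y₀, hy₀⟩, hmin⟩ := hmin
  have hmem : ∀ {y}, y ∈ θ.X N → θ.expandTo q (Nat.zero_le N) y ∈ θ.X 0 :=
    fun hy => expandTo_mem_X hq hpos _ hy
  set ψ : θ.X N → ZMod (lengthProd q N) := fun y => φ ⟨_, hmem y.2⟩ with hψ
  have hψc : Continuous ψ :=
    hc.comp (((continuous_expandTo _).comp continuous_subtype_val).subtype_mk _)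
  have key := hmin (Subtype.val '' (ψ ⁻¹' {ψ ⟨y₀, hy₀⟩})) (by simp)
    (hcl.isClosedEmbedding_subtypeVal.isClosedMap _ ((isClosed_discrete _).preimage hψc)) (by
      rintro _ ⟨y, hy, rfl⟩
      refine ⟨⟨shift y.1, shift_mem θ N y.2⟩, ?_, rfl⟩
      rw [mem_preimage, mem_singleton_iff] at hy ⊢
      rw [← hy]
      have := map_shiftBy hφ ⟨_, hmem y.2⟩ (blockLength q 0 N)
      rw [blockLength_zero_left, Int.cast_natCast, ZMod.natCast_self, add_zero] at this
      rw [hψ]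
      simp only
      rw [← this]
      congr 2
      rw [shift_eq_shiftBy, expandTo_shiftBy hpos, one_mul, blockLength_zero_left])
  have hall : ∀ y (hy : y ∈ θ.X N), ψ ⟨y, hy⟩ = ψ ⟨y₀, hy₀⟩ := by
    intro y hy
    rcases key with h | h
    · exact absurd (h ▸ ⟨⟨y₀, hy₀⟩, rfl, rfl⟩ : y₀ ∈ (∅ : Set _)) (by simp)
    · rw [← h] at hy
      obtain ⟨y', hy', rfl⟩ := hy
      exact hy'
  refine ⟨ψ ⟨y₀, hy₀⟩, ?_⟩
  rintro k ⟨_, hx⟩ ⟨y, hy, rfl⟩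
  rw [← hall y hy]
  exact map_shiftBy hφ ⟨_, hmem hy⟩ k

namespace IsTilingFactorMap

variable {π : θ.X 0 → Odometer q}

theorem continuous_coord (hπ : θ.IsTilingFactorMap q π) (N : ℕ) :
    Continuous fun x => (π x).1 N :=
  (continuous_apply N).comp (continuous_subtype_val.comp hπ.continuous)

theorem equivariant_coord (hπ : θ.IsTilingFactorMap q π) (N : ℕ) (x : θ.X 0) :
    (π (θ.shiftMap 0 x)).1 N = (π x).1 N + 1 := by
  rw [hπ.equivariant]; rfl

/-- Points of the same tile have the same image in `ℤ / p_N ℤ`, and conversely. -/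
theorem coord_eq_iff (hq : θ.HasLengthSequence q) (hpos : ∀ n, 0 < q n)
    (hmin : ∀ n, IsMinimalShift (θ.X n)) (hπ : θ.IsTilingFactorMap q π) {N : ℕ} {k : ℤ}
    {x x' : θ.X 0} (hx : x.1 ∈ θ.tile q (Nat.zero_le N) k) :
    (π x').1 N = (π x).1 N ↔ x'.1 ∈ θ.tile q (Nat.zero_le N) k := by
  obtain ⟨c, hc⟩ := exists_const_of_equivariant hq hpos (hmin N) (hπ.continuous_coord N)
    (hπ.equivariant_coord N)
  rw [hc k x hx]
  refine ⟨fun h => ?_, fun h => hc k x' h⟩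
  obtain ⟨k', hk'⟩ := exists_mem_tile hq hpos (Nat.zero_le N) x'.2
  rw [hc k' x' hk', add_right_inj, ZMod.intCast_eq_intCast_iff_dvd_sub,
    ← blockLength_zero_left] at h
  obtain ⟨t, ht⟩ := h
  rw [← tile_add_mul hq hpos _ k' t] at hk'
  rwa [show k = k' + t * blockLength q 0 N by linarith]

end IsTilingFactorMap

/-! ### Columns -/

theorem ncard_range_column (hq : θ.HasLengthSequence q) (hpos : ∀ n, 0 < q n) (m k j : ℕ)
    (hj : j < blockLength q m (m + k)) : (Set.range (θ.column m k j)).ncard =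
      (Set.range fun a => θ.expandTo q (Nat.le_add_right m k) (fun _ => a) j).ncard := by
  have : θ.column m k j =
      some ∘ fun a => θ.expandTo q (Nat.le_add_right m k) (fun _ => a) j := by
    funext a
    rw [column, comp_eq hq hpos, List.getElem?_map, List.getElem?_range hj]
    rfl
  rw [this, Set.range_comp, Set.ncard_image_of_injective _ (Option.some_injective _)]

theorem minColumnCard_le (hq : θ.HasLengthSequence q) (hpos : ∀ n, 0 < q n) {m N : ℕ} (h : m < N)
    (j : ℤ) (hj : 0 ≤ j) (hj' : j < blockLength q m N) : θ.minColumnCard q m ≤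
      (Set.range fun a => θ.expandTo q h.le (fun _ => a) j).ncard := by
  obtain ⟨k, rfl⟩ := Nat.exists_eq_add_of_le h.le
  lift j to ℕ using hj
  have hj' : j < blockLength q m (m + k) := by exact_mod_cast hj'
  rw [← ncard_range_column hq hpos m k j hj']
  exact Nat.sInf_le ⟨k, by omega, j, by rwa [← blockLength_add], rfl⟩

theorem exists_column_ncard_eq (hq : θ.HasLengthSequence q) (hpos : ∀ n, 0 < q n) (m : ℕ) :
    ∃ (N : ℕ) (h : m < N) (j : ℤ), 0 ≤ j ∧ j < blockLength q m N ∧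
      (Set.range fun a => θ.expandTo q h.le (fun _ => a) j).ncard = θ.minColumnCard q m := by
  have hne : {c | ∃ k : ℕ, 1 ≤ k ∧ ∃ j < ∏ i ∈ Finset.range k, q (m + i),
      c = (Set.range (θ.column m k j)).ncard}.Nonempty :=
    ⟨_, 1, le_rfl, 0, Finset.prod_pos fun i _ => hpos _, rfl⟩
  obtain ⟨k, hk, j, hj, h⟩ := Nat.sInf_mem hne
  rw [← blockLength_add] at hj
  refine ⟨m + k, by omega, j, by omega, by exact_mod_cast hj, ?_⟩
  rw [← ncard_range_column hq hpos m k j hj, ← h]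
  rfl

/-- A minimal column of `θ^[m,n)` is repeated in the second of at least three consecutive level-`n`
blocks. Its image can only shrink, and it is now away from both ends. -/
theorem exists_central_column (hq : θ.HasLengthSequence q) (hpos : ∀ n, 0 < q n)
    (hne : ∀ n, (θ.X n).Nonempty) (m : ℕ) :
    ∃ (N : ℕ) (h : m < N) (j : ℤ), 1 ≤ j ∧ j + 2 ≤ blockLength q m N ∧
      (Set.range fun a => θ.expandTo q h.le (fun _ => a) j).ncard ≤ θ.minColumnCard q m := by
  obtain ⟨n, hn, j, hj, hj', h⟩ := exists_column_ncard_eq (θ := θ) hq hpos m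
  obtain ⟨N, hN, hN3⟩ := exists_blockLength_gt hq hpos (hne n) 3
  have hp : (1 : ℤ) ≤ blockLength q m n := by exact_mod_cast blockLength_pos hpos m n
  refine ⟨N, hn.trans hN, j + blockLength q m n, by omega, ?_, ?_⟩
  · rw [← blockLength_mul q hn.le hN.le]
    have : (3 : ℤ) ≤ blockLength q n N := by exact_mod_cast hN3
    push_cast
    nlinarith
  · rw [← h]
    refine Set.ncard_le_ncard ?_ (Set.toFinite _)
    rintro _ ⟨a, rfl⟩
    refine ⟨θ.expandTo q hN.le (fun _ => a) 1, ?_⟩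
    have := expandTo_add_mul hpos hn.le (θ.expandTo q hN.le (fun _ => a)) j 1
    rw [one_mul] at this
    simp only
    rw [← expandTo_expandTo hn.le hN.le, this]
    refine expandTo_congr _ ?_
    rw [Int.ediv_eq_zero_of_lt hj hj', shiftBy, zero_add]

/-- Letters of `𝒜_n` need not occur in `X^(n)`, but those of some deep column do. Otherwise there
are words with a non-occurring letter at distance at least `R` from both ends, for every `R`; a
limit of these words, centred there, is a point of `X^(n)` showing such a letter. -/
theorem exists_column_subset_letters (hq : θ.HasLengthSequence q) (hpos : ∀ n, 0 < q n)
    (hne : ∀ n, (θ.X n).Nonempty) (n : ℕ) :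
    ∃ (N : ℕ) (h : n < N) (j : ℤ), 0 ≤ j ∧ j < blockLength q n N ∧
      ∀ a, ∃ y ∈ θ.X n, y 0 = θ.expandTo q h.le (fun _ => a) j := by
  by_contra! hcon
  choose N hN hN' using fun R : ℕ => exists_blockLength_gt hq hpos (hne n) (2 * R + 1)
  choose a ha using fun R : ℕ => hcon (N R) (hN R) R (by omega) (by have := hN' R; omega)
  obtain ⟨y, hy, h⟩ := exists_mem_X_eq_on_windows hq hpos
    (fun R : ℕ => shiftBy R (θ.expandTo q (hN R).le fun _ => a R)) fun R =>
      ⟨N R, hN R, a R, R, by omega, by have := hN' R; omega, fun i _ _ => rfl⟩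
  obtain ⟨l, -, hl⟩ := h 0 0
  refine ha l y hy ?_
  rw [← hl 0 (by simp) (by simp), shiftBy, zero_add]

/-- The letters at `0` of the tile contain the image of a whole column of `θ^[m,N)`: a column of
`θ^[n,N)` with values occurring in `X^(n)`, followed by the column `j` modulo the block length. -/
theorem minColumnCard_le_ncard_tile (hq : θ.HasLengthSequence q) (hpos : ∀ n, 0 < q n)
    (hne : ∀ n, (θ.X n).Nonempty) {m n : ℕ} (h : m ≤ n) (j : ℤ) :
    θ.minColumnCard q m ≤ ((fun y => y 0) '' θ.tile q h j).ncard := by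
  obtain ⟨N, hN, r, hr, hr', hy⟩ := exists_column_subset_letters (θ := θ) hq hpos hne n
  have hp : (1 : ℤ) ≤ blockLength q m n := by exact_mod_cast blockLength_pos hpos m n
  have h0 := Int.emod_nonneg j (by omega : (blockLength q m n : ℤ) ≠ 0)
  have h1 := Int.emod_lt_of_pos j (by omega : (0 : ℤ) < blockLength q m n)
  refine (minColumnCard_le hq hpos (h.trans_lt hN) (j % blockLength q m n + r * blockLength q m n)
    (by positivity) ?_).trans (Set.ncard_le_ncard ?_ (Set.toFinite _))
  · rw [← blockLength_mul q h hN.le]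
    push_cast
    nlinarith
  · rintro _ ⟨a, rfl⟩
    obtain ⟨y, hyX, hy0⟩ := hy a
    refine ⟨_, ⟨shiftBy (-(j / blockLength q m n)) y, shiftBy_mem_X hyX _, rfl⟩, ?_⟩
    simp only
    rw [← expandTo_expandTo h hN.le, expandTo_add_mul hpos, expandTo_shiftBy hpos,
      shiftBy_shiftBy, shiftBy]
    rw [show 0 + (j + -(j / blockLength q m n) * blockLength q m n) = j % blockLength q m n by
      rw [Int.emod_def]; ring]
    refine expandTo_congr _ ?_
    rw [Int.ediv_eq_zero_of_lt h0 h1, shiftBy, zero_add, hy0]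

/-! ### Cardinalities of fibres -/

theorem exists_fibre_encard_le (hq : θ.HasLengthSequence q) (hpos : ∀ n, 0 < q n)
    (hmin : ∀ n, IsMinimalShift (θ.X n)) {π : θ.X 0 → Odometer q}
    (hπ : θ.IsTilingFactorMap q π) : ∃ z, (π ⁻¹' {z}).encard ≤ θ.naiveColumnNumber q := by
  have hne : ∀ n, (θ.X n).Nonempty := fun n => (hmin n).2.2.1
  choose N hN J hJ hJ' hcard using exists_central_column (θ := θ) hq hpos hne
  set M : ℕ → ℕ := fun i => N^[i] 0 with hM
  have hMs : ∀ i, M (i + 1) = N (M i) := fun i => Function.iterate_succ_apply' N i 0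
  -- Mixed-radix expansion with digits `J`: the position, in the level-`M i` block, of the origin of
  -- the points of the fibre.
  set k : ℕ → ℤ := fun i => Nat.rec 0 (fun i r => r + J (M i) * blockLength q 0 (M i)) i with hk
  have hks : ∀ i, k (i + 1) = k i + J (M i) * blockLength q 0 (M i) := fun i => rfl
  -- Central digits gain at least one unit of margin on each side, so `[-i, i]` lies inside one
  -- level-`M i` block.
  have hbound : ∀ i : ℕ, i ≤ k i ∧ k i + i + 1 ≤ blockLength q 0 (M i) := by
    intro i
    induction i with
    | zero => simp [hk, hM, blockLength_self]
    | succ i ih =>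
      have h1 := hJ (M i)
      have h2 := hJ' (M i)
      rw [hks, hMs, ← blockLength_mul q (Nat.zero_le _) (hN (M i)).le]
      push_cast
      constructor <;> nlinarith
  have hsucc : ∀ i x, x ∈ θ.tile q (Nat.zero_le (M (i + 1))) (k (i + 1)) →
      ∃ w ∈ θ.tile q (hN (M i)).le (J (M i)),
        x = shiftBy (k i) (θ.expandTo q (Nat.zero_le (M i)) w) := by
    intro i x hx
    rw [hks] at hx
    exact exists_of_mem_tile_trans hpos (Nat.zero_le (M i)) (hN (M i)).le (by convert hx; exact (hMs i).symm)
  obtain ⟨x₀, hx₀⟩ := IsCompact.nonempty_iInter_of_sequence_nonempty_isCompact_isClosed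
    (fun i => θ.tile q (Nat.zero_le (M i)) (k i))
    (fun i x hx => by
      obtain ⟨w, hw, rfl⟩ := hsucc i x hx
      exact ⟨w, tile_subset_X hq hpos _ _ hw, rfl⟩)
    (fun i => (hne _).image _) (isCompact_tile _ _) (fun i => isClosed_tile _ _)
  rw [mem_iInter] at hx₀
  have hx₀X : x₀ ∈ θ.X 0 := tile_subset_X hq hpos _ _ (hx₀ 0)
  refine ⟨π ⟨x₀, hx₀X⟩, ?_⟩
  by_contra! hlt
  obtain ⟨C, hC⟩ := ENat.ne_top_iff_exists.1 hlt.ne_top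
  rw [← hC] at hlt
  -- The bound equals a finite `C`. Some window `[-i, i]` separates `C + 1` points of the fibre, yet
  -- its content is fixed by one of at most `C` letters.
  obtain ⟨t, hts, htc⟩ := Set.exists_subset_encard_eq (Order.add_one_le_of_lt hlt)
  have htfin : t.Finite := Set.finite_of_encard_eq_coe (k := C + 1) (by rw [htc]; norm_cast)
  have hdiff : ∀ x x' : θ.X 0, ∃ R : ℕ, (∀ l : ℤ, -R ≤ l → l ≤ R → x.1 l = x'.1 l) → x = x' := by
    intro x x'
    by_cases h : x = x'
    · exact ⟨0, fun _ => h⟩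
    · obtain ⟨l, hl⟩ : ∃ l, x.1 l ≠ x'.1 l := by
        by_contra! h'
        exact h (Subtype.ext (funext h'))
      exact ⟨l.natAbs, fun h' => absurd (h' l (by omega) (by omega)) hl⟩
  choose R hR using hdiff
  obtain ⟨i, hi⟩ := ((htfin.prod htfin).image fun p => R p.1 p.2).bddAbove
  have hi : ∀ x ∈ t, ∀ x' ∈ t, R x x' ≤ i := fun x hx x' hx' => hi ⟨(x, x'), ⟨hx, hx'⟩, rfl⟩
  have hletter : ∀ x ∈ t, ∃ b ∈ Set.range (fun a => θ.expandTo q (hN (M i)).le (fun _ => a)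
      (J (M i))), ∀ l : ℤ, -i ≤ l → l ≤ i →
        x.1 l = θ.expandTo q (Nat.zero_le (M i)) (fun _ => b) (l + k i) := by
    intro x hx
    have hxt : x.1 ∈ θ.tile q (Nat.zero_le (M (i + 1))) (k (i + 1)) :=
      (hπ.coord_eq_iff hq hpos hmin (x := ⟨x₀, hx₀X⟩) (hx₀ (i + 1))).1
        (congrArg (fun z : Odometer q => z.1 (M (i + 1))) (hts hx))
    obtain ⟨_, ⟨y, hy, rfl⟩, hxw⟩ := hsucc i _ hxt
    refine ⟨_, ⟨y (J (M i) / blockLength q (M i) (N (M i))), rfl⟩, fun l hl hl' => ?_⟩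
    simp only
    rw [← expandTo_eq_const, hxw, shiftBy]
    refine expandTo_congr _ ?_
    have := hbound i
    rw [Int.ediv_eq_zero_of_lt (by omega) (by omega)]
    simp only [shiftBy, zero_add]
  have : Nonempty (θ.Alphabet (M i)) := ⟨(hne (M i)).some 0⟩
  choose! b hb hb' using hletter
  have hinj : Set.InjOn b t := by
    intro x hx x' hx' hbb
    refine hR x x' fun l hl hl' => ?_
    have := hi x hx x' hx'
    rw [hb' x hx l (by omega) (by omega), hb' x' hx' l (by omega) (by omega), hbb]
  have hle := Set.ncard_le_ncard_of_injOn b hb hinj (Set.toFinite _)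
  have h1 : t.ncard = C + 1 := by
    rw [Set.ncard, htc]; norm_cast
  have h2 : (θ.minColumnCard q (M i) : ℕ∞) ≤ C := by
    rw [hC]; exact le_iSup (fun m => (θ.minColumnCard q m : ℕ∞)) (M i)
  have h3 := hcard (M i)
  have h2 : θ.minColumnCard q (M i) ≤ C := by exact_mod_cast h2
  omega

theorem naiveColumnNumber_le_fibre_encard (hq : θ.HasLengthSequence q) (hpos : ∀ n, 0 < q n)
    (hmin : ∀ n, IsMinimalShift (θ.X n)) (hinj : θ.IsInjective) {π : θ.X 0 → Odometer q}
    (hπ : θ.IsTilingFactorMap q π) (z : Odometer q) :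
    θ.naiveColumnNumber q ≤ (π ⁻¹' {z}).encard := by
  have hne : ∀ n, (θ.X n).Nonempty := fun n => (hmin n).2.2.1
  obtain ⟨x₀, rfl⟩ := hπ.surjective z
  refine iSup_le fun m => ?_
  obtain ⟨k₀, hk₀⟩ := exists_mem_tile hq hpos (Nat.zero_le m) x₀.2
  -- All positions of `x₀` agree with `k₀` modulo `p_m`; the quotient `j` is the position seen from
  -- level `m`.
  have hex : ∀ n, ∃ j : ℤ, x₀.1 ∈ θ.tile q (Nat.zero_le (m + n)) (k₀ + j * blockLength q 0 m) := by
    intro n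
    obtain ⟨k, hk⟩ := exists_mem_tile hq hpos (Nat.zero_le (m + n)) x₀.2
    have hk' : x₀.1 ∈ θ.tile q (Nat.zero_le m) k := by
      have := tile_trans_subset hq hpos (Nat.zero_le m) (Nat.le_add_right m n) k 0
      rw [zero_mul, add_zero] at this
      exact this hk
    obtain ⟨c, hc⟩ := exists_const_of_equivariant hq hpos (hmin m) (hπ.continuous_coord m)
      (hπ.equivariant_coord m)
    have := (hc k₀ x₀ hk₀).symm.trans (hc k x₀ hk')
    rw [add_right_inj, ZMod.intCast_eq_intCast_iff_dvd_sub, ← blockLength_zero_left] at this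
    obtain ⟨t, ht⟩ := this
    exact ⟨t, by rwa [show k₀ + t * blockLength q 0 m = k by linarith]⟩
  choose j hj using hex
  set T : ℕ → Set (θ.Alphabet m) := fun n =>
    (fun y => y 0) '' θ.tile q (Nat.le_add_right m n) (j n) with hT
  have hmono : ∀ n, θ.tile q (Nat.le_add_right m (n + 1)) (j (n + 1)) ⊆
      θ.tile q (Nat.le_add_right m n) (j n) := by
    intro n
    obtain ⟨c, hc⟩ := exists_const_of_equivariant hq hpos (hmin (m + n))
      (hπ.continuous_coord (m + n)) (hπ.equivariant_coord (m + n))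
    have h1 := tile_trans_subset hq hpos (Nat.zero_le (m + n)) (Nat.le_succ (m + n))
      (k₀ + j (n + 1) * blockLength q 0 m) 0
    rw [zero_mul, add_zero] at h1
    have := (hc _ x₀ (hj n)).symm.trans (hc _ x₀ (h1 (hj (n + 1))))
    rw [add_right_inj, ZMod.intCast_eq_intCast_iff_dvd_sub, ← blockLength_zero_left,
      ← blockLength_mul q (Nat.zero_le m) (Nat.le_add_right m n)] at this
    obtain ⟨t, ht⟩ := this
    have hp : (blockLength q 0 m : ℤ) ≠ 0 := by exact_mod_cast (blockLength_pos hpos 0 m).ne'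
    have hjt : j (n + 1) = j n + t * blockLength q m (m + n) := by
      refine mul_right_cancel₀ hp ?_
      push_cast at ht
      linear_combination ht
    rw [hjt]
    exact tile_trans_subset hq hpos (Nat.le_add_right m n) (Nat.le_succ (m + n)) _ _
  have hTanti : Antitone T := antitone_nat_of_succ_le fun n => Set.image_mono (hmono n)
  obtain ⟨n₀, hn₀⟩ : ∃ n₀, ∀ n, (T n₀).ncard ≤ (T n).ncard := by
    obtain ⟨n₀, h⟩ := Nat.sInf_mem (Set.range_nonempty fun n => (T n).ncard)
    exact ⟨n₀, fun n => by simp only at h; rw [h]; exact Nat.sInf_le ⟨n, rfl⟩⟩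
  have hTall : ∀ n, T n₀ ⊆ T n := by
    intro n
    rcases le_total n n₀ with h | h
    · exact hTanti h
    · exact (Set.eq_of_subset_of_ncard_le (hTanti h) (hn₀ n) (Set.toFinite _)).symm.subset
  have hlift : ∀ b ∈ T n₀, ∃ y : ℤ → θ.Alphabet m, y 0 = b ∧
      ∀ n, y ∈ θ.tile q (Nat.le_add_right m n) (j n) := by
    intro b hb
    have hb0 : IsClosed {y : ℤ → θ.Alphabet m | y 0 = b} :=
      isClosed_singleton.preimage (f := fun y : ℤ → θ.Alphabet m => y 0) (continuous_apply 0)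
    obtain ⟨y, hy⟩ := IsCompact.nonempty_iInter_of_sequence_nonempty_isCompact_isClosed
      (fun n => θ.tile q (Nat.le_add_right m n) (j n) ∩ {y | y 0 = b})
      (fun n => Set.inter_subset_inter_left _ (hmono n))
      (fun n => by
        obtain ⟨y, hy, hy'⟩ := hTall n hb
        exact ⟨y, hy, hy'⟩)
      ((isCompact_tile _ _).inter_right hb0) (fun n => (isClosed_tile _ _).inter hb0)
    rw [mem_iInter] at hy
    exact ⟨y, (hy 0).2, fun n => (hy n).1⟩
  have : Nonempty (θ.Alphabet m) := ⟨(hne m).some 0⟩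
  choose! y hy0 hy using hlift
  have hyX : ∀ b ∈ T n₀, y b ∈ θ.X m := fun b hb => tile_subset_X hq hpos _ _ (hy b hb 0)
  set g : θ.Alphabet m → ℤ → θ.Alphabet 0 := fun b =>
    shiftBy k₀ (θ.expandTo q (Nat.zero_le m) (y b)) with hg
  have hgX : ∀ b ∈ T n₀, g b ∈ θ.X 0 := fun b hb =>
    shiftBy_mem_X (expandTo_mem_X hq hpos _ (hyX b hb)) _
  have hgtile : ∀ b ∈ T n₀, ∀ n,
      g b ∈ θ.tile q (Nat.zero_le (m + n)) (k₀ + j n * blockLength q 0 m) := by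
    intro b hb n
    obtain ⟨w, hw, hw'⟩ := hy b hb n
    refine ⟨w, hw, ?_⟩
    simp only [hg, ← hw']
    rw [expandTo_shiftBy hpos, shiftBy_shiftBy, expandTo_expandTo]
  have hcoord : ∀ b (hb : b ∈ T n₀) n, (π ⟨g b, hgX b hb⟩).1 n = (π x₀).1 n := by
    intro b hb n
    -- Coordinate `n` is compared through the finer tiles of level `m + n`, which treats `n < m` and
    -- `n ≥ m` alike.
    have sub : ∀ k, θ.tile q (Nat.zero_le (m + n)) k ⊆ θ.tile q (Nat.zero_le n) k := by
      intro k
      have := tile_trans_subset hq hpos (Nat.zero_le n) (Nat.le_add_left n m) k 0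
      rwa [zero_mul, add_zero] at this
    exact (hπ.coord_eq_iff hq hpos hmin (sub _ (hj n))).2 (sub _ (hgtile b hb n))
  have himg : g '' T n₀ ⊆ Subtype.val '' (π ⁻¹' {π x₀}) := by
    rintro _ ⟨b, hb, rfl⟩
    exact ⟨⟨g b, hgX b hb⟩, Subtype.ext (funext (hcoord b hb)), rfl⟩
  have hginj : Set.InjOn g (T n₀) := by
    intro b hb b' hb' h
    have h1 : θ.expandTo q (Nat.zero_le m) (y b) = θ.expandTo q (Nat.zero_le m) (y b') := by
      have := congrArg (shiftBy (-k₀)) h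
      simpa [hg, shiftBy_shiftBy, shiftBy_zero] using this
    rw [← hy0 b hb, ← hy0 b' hb', expandTo_injective hq hinj _ h1]
  calc (θ.minColumnCard q m : ℕ∞) ≤ ((T n₀).ncard : ℕ∞) := by
        exact_mod_cast minColumnCard_le_ncard_tile hq hpos hne _ _
    _ = (T n₀).encard := (Set.toFinite _).cast_ncard_eq
    _ = (g '' T n₀).encard := hginj.encard_image.symm
    _ ≤ (Subtype.val '' (π ⁻¹' {π x₀})).encard := Set.encard_le_encard himg
    _ = (π ⁻¹' {π x₀}).encard := Subtype.val_injective.encard_image _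

theorem fibre_encard (hq : θ.HasLengthSequence q) (hinj : θ.IsInjective)
    (hmin : ∀ n, IsMinimalShift (θ.X n)) {π : θ.X 0 → Odometer q}
    (hπ : θ.IsTilingFactorMap q π) :
    (∃ z, (π ⁻¹' {z}).encard = θ.naiveColumnNumber q) ∧
      ∀ k : ℕ, (k : ℕ∞) < θ.naiveColumnNumber q → ∀ z, (π ⁻¹' {z}).encard ≠ k := by
  have hpos := length_pos hq fun n => (hmin n).2.2.1
  have hlow := naiveColumnNumber_le_fibre_encard hq hpos hmin hinj hπ
  obtain ⟨z, hz⟩ := exists_fibre_encard_le hq hpos hmin hπ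
  exact ⟨⟨z, hz.antisymm (hlow z)⟩, fun k hk z hz => (hlow z).not_gt (hz ▸ hk)⟩

end DirectiveSequence

/-! ### The Morse–Hedlund theorem -/

theorem dropLast_subword {A : Type u} (f : ℤ → A) (i : ℤ) (l : ℕ) :
    (subword f i (l + 1)).dropLast = subword f i l := by
  rw [subword_eq_map, subword_eq_map, List.range_succ]
  simp

theorem subword_succ {A : Type u} (f : ℤ → A) (i : ℤ) (l : ℕ) :
    subword f i (l + 1) = f i :: subword f (i + 1) l := by
  rw [subword_eq_map, subword_eq_map, List.range_succ_eq_map]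
  simp [Function.comp_def, add_comm, add_left_comm]

/-- A two-sided sequence with at most `M` subwords of length `M` is periodic. -/
theorem exists_period_of_ncard_subword_le {A : Type u} (f : ℤ → A) (M : ℕ)
    (hfin : (Set.range fun i => subword f i M).Finite)
    (hle : (Set.range fun i => subword f i M).ncard ≤ M) :
    ∃ k : ℕ, 1 ≤ k ∧ ∀ i, f (i + k) = f i := by
  set W : ℕ → Set (List A) := fun l => Set.range fun i => subword f i l with hW
  have hdrop : ∀ l, W l = List.dropLast '' W (l + 1) := by
    intro l
    simp only [hW, ← Set.range_comp, Function.comp_def, dropLast_subword]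
  have htail : ∀ l, W l = List.tail '' W (l + 1) := by
    intro l
    simp only [hW, ← Set.range_comp, Function.comp_def, subword_succ, List.tail_cons]
    exact (Set.range_comp_subset_range (fun i : ℤ => i + 1) fun i => subword f i l).antisymm'
      (by rintro _ ⟨i, rfl⟩; exact ⟨i - 1, by simp⟩)
  have hWfin : ∀ l ≤ M, (W l).Finite := fun l hl =>
    Nat.decreasingInduction (motive := fun l _ => (W l).Finite)
      (fun l _ h => by rw [hdrop]; exact h.image _) hfin hl
  -- Starting from at least one empty word, `M` strict increases would give more than `M` words.
  -- Where growth stops, words of length `l` extend uniquely on both sides.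
  obtain ⟨l, hl, hcard⟩ : ∃ l < M, (W (l + 1)).ncard ≤ (W l).ncard := by
    by_contra! hcon
    have : ∀ l ≤ M, l + 1 ≤ (W l).ncard := by
      intro l hl
      induction l with
      | zero => exact (Set.ncard_pos (hWfin 0 hl)).2 (Set.range_nonempty _)
      | succ l ih => have := hcon l hl; have := ih (by omega); omega
    have := this M le_rfl
    simp only [hW] at this
    omega
  have hfin1 := hWfin (l + 1) hl
  have hinj : ∀ g : List A → List A, W l = g '' W (l + 1) → Set.InjOn g (W (l + 1)) := by
    intro g hg
    refine Set.injOn_of_ncard_image_eq (le_antisymm (Set.ncard_image_le hfin1) ?_) hfin1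
    rwa [← hg]
  have hinj1 := hinj _ (hdrop l)
  have hinj2 := hinj _ (htail l)
  have hext : ∀ i j, subword f i l = subword f j l → subword f i (l + 1) = subword f j (l + 1) :=
    fun i j h => hinj1 ⟨i, rfl⟩ ⟨j, rfl⟩ (by simpa only [dropLast_subword] using h)
  have hsucc : ∀ i j, subword f i l = subword f j l → subword f (i + 1) l = subword f (j + 1) l := by
    intro i j h
    have := congrArg List.tail (hext i j h)
    simpa only [subword_succ, List.tail_cons] using this
  have hpred : ∀ i j, subword f (i + 1) l = subword f (j + 1) l → subword f i l = subword f j l := by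
    intro i j h
    have : subword f i (l + 1) = subword f j (l + 1) :=
      hinj2 ⟨i, rfl⟩ ⟨j, rfl⟩ (by simpa only [subword_succ, List.tail_cons] using h)
    simpa only [dropLast_subword] using congrArg List.dropLast this
  obtain ⟨i, j, hij, h⟩ : ∃ i j : ℤ, i < j ∧ subword f i l = subword f j l := by
    have hni : ¬ Function.Injective fun i => subword f i l := fun h =>
      Set.infinite_range_of_injective h (hWfin l hl.le)
    rw [Function.not_injective_iff] at hni
    obtain ⟨i, j, h, hne⟩ := hni
    rcases lt_or_gt_of_ne hne with h' | h'
    · exact ⟨i, j, h', h⟩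
    · exact ⟨j, i, h', h.symm⟩
  have hall : ∀ t : ℤ, subword f (i + t) l = subword f (j + t) l := by
    intro t
    induction t using Int.induction_on with
    | zero => simpa using h
    | succ t ih => simpa only [add_assoc] using hsucc _ _ ih
    | pred t ih => exact hpred _ _ (by simpa only [add_assoc, sub_add_cancel] using ih)
  refine ⟨(j - i).toNat, by omega, fun t => ?_⟩
  have := hext _ _ (hall (t - i))
  rw [subword_succ, subword_succ, List.cons.injEq] at this
  rw [Int.toNat_of_nonneg (by omega)]
  rw [show t + (j - i) = j + (t - i) by ring, ← this.1]
  congr 1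
  ring

namespace DirectiveSequence

variable {θ : DirectiveSequence.{u}} {q : ℕ → ℕ}

/-! ### Cyclic factors -/

/-- The `y ∈ X^(N)` whose image lies in the second tile form a closed set, shift-invariant because
translation by the block length fixes every tile; minimality applies. -/
theorem tile_eq_of_nonempty_inter (hpos : ∀ n, 0 < q n) (hq : θ.HasLengthSequence q) {N : ℕ}
    (hmin : IsMinimalShift (θ.X N)) {m : ℕ} (h : m ≤ N) {k l : ℤ}
    (hkl : (θ.tile q h k ∩ θ.tile q h l).Nonempty) : θ.tile q h k = θ.tile q h l := by
  have key : ∀ k l, (θ.tile q h k ∩ θ.tile q h l).Nonempty → θ.tile q h k ⊆ θ.tile q h l := by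
    rintro k l ⟨_, ⟨y₀, hy₀, rfl⟩, hy₀'⟩
    have := hmin.2.2.2 (θ.X N ∩ (fun y => shiftBy k (θ.expandTo q h y)) ⁻¹' θ.tile q h l)
      Set.inter_subset_left
      (hmin.1.inter ((isClosed_tile h l).preimage
        ((continuous_shiftBy k).comp (continuous_expandTo h)))) (by
        rintro y ⟨hy, hy'⟩
        refine ⟨shift_mem θ N hy, ?_⟩
        have := shiftBy_mem_tile hy' (blockLength q m N)
        rw [shiftBy_shiftBy, add_comm _ k, add_comm _ l, ← one_mul (blockLength q m N : ℤ),
          tile_add_mul hq hpos, ← shiftBy_shiftBy, ← expandTo_shiftBy hpos] at this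
        exact this)
    rcases this with h' | h'
    · exact absurd (h' ▸ ⟨hy₀, hy₀'⟩ : y₀ ∈ (∅ : Set _)) (by simp)
    · rintro _ ⟨y, hy, rfl⟩
      rw [← h'] at hy
      exact hy.2
  exact (key k l hkl).antisymm (key l k (by rwa [Set.inter_comm]))

theorem shiftBy_image_tile {m N : ℕ} (h : m ≤ N) (k l : ℤ) :
    shiftBy l '' θ.tile q h k = θ.tile q h (l + k) := by
  rw [tile, tile, Set.image_image]
  simp only [shiftBy_shiftBy]

/-- The tiles `σ^k θ^[0,N)(X^(N))` are permuted cyclically by the shift. Their number is a divisor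
of the length of `θ^[0,N)`. -/
theorem exists_tile_eq_iff (hq : θ.HasLengthSequence q) (hpos : ∀ n, 0 < q n) {m N : ℕ}
    (h : m ≤ N) : ∃ d : ℕ, d ∣ blockLength q m N ∧
      ∀ k l : ℤ, θ.tile q h k = θ.tile q h l ↔ (d : ℤ) ∣ k - l := by
  have hadd : ∀ a k l : ℤ, θ.tile q h k = θ.tile q h l → θ.tile q h (a + k) = θ.tile q h (a + l) := by
    intro a k l hkl
    rw [← shiftBy_image_tile, hkl, shiftBy_image_tile]
  let G : AddSubgroup ℤ :=
    { carrier := {k | θ.tile q h k = θ.tile q h 0}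
      zero_mem' := rfl
      add_mem' := by
        intro a b ha hb
        have := hadd a b 0 hb
        rw [add_zero] at this
        exact this.trans ha
      neg_mem' := by
        intro a ha
        have := hadd (-a) a 0 ha
        rw [neg_add_cancel, add_zero] at this
        exact this.symm }
  have hG : ∀ k, k ∈ G ↔ θ.tile q h k = θ.tile q h 0 := fun k => Iff.rfl
  obtain ⟨d, hd⟩ := Int.subgroup_cyclic G
  have hd' : ∀ k, k ∈ G ↔ (d.natAbs : ℤ) ∣ k := by
    intro k
    rw [hd, ← AddSubgroup.zmultiples_eq_closure, Int.mem_zmultiples_iff, Int.natAbs_dvd]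
  refine ⟨d.natAbs, ?_, fun k l => ?_⟩
  · rw [← Int.natCast_dvd_natCast, ← hd', hG]
    have := tile_add_mul (θ := θ) hq hpos h 0 1
    rwa [zero_add, one_mul] at this
  · rw [← hd', hG]
    constructor
    · intro hkl
      have := hadd (-l) k l hkl
      rwa [neg_add_cancel, neg_add_eq_sub] at this
    · intro hkl
      have := hadd l _ _ hkl
      rwa [add_sub_cancel, add_zero] at this

/-- Tiles that meet are equal, so the index of the tile containing `x` is well defined modulo `d`;
its level sets are the finitely many closed tiles. -/
theorem exists_equivariant_map_zmod (hq : θ.HasLengthSequence q) (hpos : ∀ n, 0 < q n) {N : ℕ}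
    (hmin : IsMinimalShift (θ.X N)) {d : ℕ} (hd : d ∣ blockLength q 0 N)
    (htile : ∀ k l : ℤ, θ.tile q (Nat.zero_le N) k = θ.tile q (Nat.zero_le N) l ↔ (d : ℤ) ∣ k - l) :
    ∃ φ : θ.X 0 → ZMod d, Continuous φ ∧ ∀ x, φ (θ.shiftMap 0 x) = φ x + 1 := by
  choose κ hκ using fun x : θ.X 0 => exists_mem_tile hq hpos (Nat.zero_le N) x.2
  have : NeZero d := ⟨(Nat.pos_of_dvd_of_pos hd (blockLength_pos hpos 0 N)).ne'⟩
  have hφ : ∀ (x : θ.X 0) (k : ℤ), (κ x : ZMod d) = k ↔ x.1 ∈ θ.tile q (Nat.zero_le N) k := by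
    intro x k
    rw [eq_comm, ZMod.intCast_eq_intCast_iff_dvd_sub, ← htile]
    refine ⟨fun h => h ▸ hκ x, fun h => tile_eq_of_nonempty_inter hpos hq hmin _ ⟨x, hκ x, h⟩⟩
  refine ⟨fun x => (κ x : ZMod d), continuous_iff_isClosed.2 fun s _ => ?_, fun x => ?_⟩
  · rw [← Set.biUnion_preimage_singleton]
    refine s.toFinite.isClosed_biUnion fun c _ => ?_
    obtain ⟨k, rfl⟩ := ZMod.intCast_surjective c
    have : (fun x => (κ x : ZMod d)) ⁻¹' {(k : ZMod d)} =
        Subtype.val ⁻¹' θ.tile q (Nat.zero_le N) k := Set.ext fun x => hφ x k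
    rw [this]
    exact (isClosed_tile _ k).preimage continuous_subtype_val
  · have := (hφ (θ.shiftMap 0 x) (1 + κ x)).2 (shiftBy_mem_tile (hκ x) 1)
    simp only
    rw [this]
    push_cast
    rw [add_comm]

theorem blockLength_lt_mul_card (hq : θ.HasLengthSequence q) (hpos : ∀ n, 0 < q n)
    (hne : ∀ n, (θ.X n).Nonempty) (haper : IsAperiodicShift (θ.X 0)) {N d : ℕ}
    (hd : d ∣ blockLength q 0 N)
    (htile : ∀ k l : ℤ, θ.tile q (Nat.zero_le N) k = θ.tile q (Nat.zero_le N) l ↔ (d : ℤ) ∣ k - l) :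
    blockLength q 0 N < d * Nat.card (θ.Alphabet N) := by
  have hd0 : 0 < d := Nat.pos_of_dvd_of_pos hd (blockLength_pos hpos 0 N)
  obtain ⟨M, hM⟩ := hd
  rw [hM]
  refine Nat.mul_lt_mul_of_pos_left ?_ hd0
  by_contra! hcard
  obtain ⟨y₀, hy₀⟩ := hne N
  set x := shiftBy 0 (θ.expandTo q (Nat.zero_le N) y₀) with hx
  have hxt : x ∈ θ.tile q (Nat.zero_le N) 0 := ⟨y₀, hy₀, rfl⟩
  have hblock : ∀ i : ℤ, ∃ a, ∀ r : ℤ, 0 ≤ r → r < blockLength q 0 N →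
      x (d * i + r) = θ.expandTo q (Nat.zero_le N) (fun _ => a) r := by
    intro i
    -- The tile is invariant under translation by `d`, so a full level-`N` block of `x` can be read
    -- from every multiple of `d`, although such blocks may overlap.
    have : x ∈ θ.tile q (Nat.zero_le N) (-(d * i)) := by
      rwa [(htile (-(d * i)) 0).2 (by simp)]
    obtain ⟨y, -, hy⟩ := this
    refine ⟨y 0, fun r hr hr' => ?_⟩
    rw [← hy]
    simp only [shiftBy]
    rw [show d * i + r + -(d * i) = r by ring, expandTo_eq_const,
      Int.ediv_eq_zero_of_lt hr hr']
  choose a ha using hblock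
  -- Recoded over `d`-blocks, an `M`-word of `f` spans `dM = p_N` letters and is determined by one
  -- letter of `𝒜_N`.
  set f : ℤ → Fin d → θ.Alphabet 0 := fun i t => x (d * i + t) with hf
  have hsub : (Set.range fun i => subword f i M) ⊆ Set.range fun b : θ.Alphabet N =>
      (List.range M).map fun s (t : Fin d) =>
        θ.expandTo q (Nat.zero_le N) (fun _ => b) ((d * s + t : ℕ) : ℤ) := by
    rintro _ ⟨i, rfl⟩
    refine ⟨a i, ?_⟩
    simp only
    rw [subword_eq_map]
    refine List.map_congr_left fun s hs => ?_
    rw [List.mem_range] at hs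
    funext t
    have hlt : d * s + t < blockLength q 0 N := by
      rw [hM]
      have := t.2
      nlinarith
    rw [← ha i _ (by omega) (by exact_mod_cast hlt), hf]
    simp only
    congr 1
    push_cast
    ring
  obtain ⟨k, hk, hper⟩ := exists_period_of_ncard_subword_le f M ((Set.toFinite _).subset hsub)
    ((Set.ncard_le_ncard hsub (Set.toFinite _)).trans (by
      rw [← Set.image_univ]
      exact (Set.ncard_image_le Set.finite_univ).trans (by rwa [Set.ncard_univ])))
  refine haper x (tile_subset_X hq hpos _ _ hxt) (d * k) (Nat.mul_pos hd0 hk) ?_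
  rw [shift_iterate]
  funext j
  have h0 := Int.emod_nonneg j (by omega : (d : ℤ) ≠ 0)
  have h1 := Int.emod_lt_of_pos j (by omega : (0 : ℤ) < d)
  have := congrFun (hper (j / d)) ⟨(j % d).toNat, by omega⟩
  simp only [hf, Int.toNat_of_nonneg h0] at this
  rw [mul_add, add_right_comm, Int.mul_ediv_add_emod] at this
  rw [shiftBy, ← this]
  push_cast
  rfl

/-! ### Divisibility of lengths and existence of the tiling factor map -/

theorem exists_dvd_blockLength
    (hprime : ∀ p : ℕ, p.Prime → (∃ k, p ∣ q k) → ∀ N, ∃ n ≥ N, p ∣ q n) (x : ℕ) (hx : x ≠ 0)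
    (hxq : ∀ p : ℕ, p.Prime → p ∣ x → ∃ k, p ∣ q k) (m : ℕ) :
    ∃ N ≥ m, x ∣ blockLength q m N := by
  induction x using induction_on_primes with
  | zero => exact absurd rfl hx
  | one => exact ⟨m, le_rfl, one_dvd _⟩
  | prime_mul p x hp ih =>
    obtain ⟨N, hN, h⟩ := ih (by rintro rfl; simp at hx)
      fun r hr hrx => hxq r hr (Dvd.dvd.mul_left hrx p)
    obtain ⟨n, hn, hpn⟩ := hprime p hp (hxq p hp (dvd_mul_right p x)) N
    refine ⟨n + 1, by omega, ?_⟩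
    rw [blockLength_succ q (hN.trans hn), mul_comm p x, ← blockLength_mul q hN hn]
    exact mul_dvd_mul (h.mul_right _) hpn

/-- If `p^k ∣ x` with `k ≥ 1`, then `v_p(d) ≥ k(B+1) - v_p(M)`, and `v_p(M) < M ≤ B` leaves at least
`k`. -/
theorem dvd_of_pow_dvd_mul {x d M B : ℕ} (hM : M ≠ 0) (hMB : M ≤ B) (hd : d ≠ 0)
    (h : x ^ (B + 1) ∣ d * M) : x ∣ d := by
  rw [Nat.dvd_iff_prime_pow_dvd_dvd]
  intro p k hp hpk
  rcases Nat.eq_zero_or_pos k with rfl | hk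
  · simp
  have h1 : p ^ (k * (B + 1)) ∣ d * M := by
    rw [pow_mul]
    exact (pow_dvd_pow_of_dvd hpk _).trans h
  rw [hp.pow_dvd_iff_le_factorization (mul_ne_zero hd hM), Nat.factorization_mul hd hM,
    Finsupp.add_apply] at h1
  rw [hp.pow_dvd_iff_le_factorization hd]
  have := Nat.factorization_lt p hM
  nlinarith

theorem exists_equivariant_map_lengthProd (hb : θ.BoundedAlphabets) (htf : θ.IsTorsionFree q)
    (n : ℕ) : ∃ φ : θ.X 0 → ZMod (lengthProd q n),
      Continuous φ ∧ ∀ x, φ (θ.shiftMap 0 x) = φ x + 1 := by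
  have hq := htf.hasLength
  have hne : ∀ n, (θ.X n).Nonempty := fun n => (htf.minimal n).2.2.1
  have hpos := length_pos hq hne
  obtain ⟨B, hB⟩ := hb
  obtain ⟨N, -, hN⟩ := exists_dvd_blockLength htf.prime_dvd (blockLength q 0 n ^ (B + 1))
    (pow_ne_zero _ (blockLength_pos hpos 0 n).ne') (fun p hp hpx => by
      obtain ⟨k, -, hk⟩ := (hp.prime.dvd_finsetProd_iff _).1 (hp.dvd_of_dvd_pow hpx)
      exact ⟨k, hk⟩) 0
  obtain ⟨d, hd, htile⟩ := exists_tile_eq_iff (θ := θ) hq hpos (Nat.zero_le N)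
  obtain ⟨φ, hφc, hφ⟩ := exists_equivariant_map_zmod hq hpos (htf.minimal N) hd htile
  have hlt := blockLength_lt_mul_card hq hpos hne htf.aperiodic hd htile
  have hbl := blockLength_pos hpos 0 N
  obtain ⟨M, hM⟩ := hd
  rw [hM] at hlt hN hbl
  have hdvd : lengthProd q n ∣ d := by
    rw [← blockLength_zero_left]
    exact dvd_of_pow_dvd_mul (Nat.pos_of_mul_pos_left hbl).ne'
      ((Nat.lt_of_mul_lt_mul_left hlt).le.trans (hB N)) (Nat.pos_of_mul_pos_right hbl).ne' hN
  exact ⟨fun x => ZMod.castHom hdvd _ (φ x), continuous_of_discreteTopology.comp hφc,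
    fun x => by simp only [hφ, map_add, map_one]⟩

theorem equivariant_ext (hmin : IsMinimalShift (θ.X 0)) {p : ℕ} {φ ψ : θ.X 0 → ZMod p}
    (hφc : Continuous φ) (hψc : Continuous ψ) (hφ : ∀ x, φ (θ.shiftMap 0 x) = φ x + 1)
    (hψ : ∀ x, ψ (θ.shiftMap 0 x) = ψ x + 1) {x₀ : θ.X 0} (h : φ x₀ = ψ x₀) : φ = ψ := by
  have := hmin.2.2.2 (Subtype.val '' {x | φ x = ψ x}) (by simp)
    (hmin.1.isClosedEmbedding_subtypeVal.isClosedMap _ (isClosed_eq hφc hψc)) (by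
      rintro _ ⟨x, hx, rfl⟩
      refine ⟨θ.shiftMap 0 x, ?_, rfl⟩
      rw [mem_ofPred_eq] at hx ⊢
      rw [hφ, hψ, hx])
  rcases this with h' | h'
  · exact absurd (h' ▸ ⟨x₀, h, rfl⟩ : x₀.1 ∈ (∅ : Set _)) (by simp)
  · funext x
    obtain ⟨x', hx', hxx⟩ := h'.superset x.2
    rw [← Subtype.ext hxx]
    exact hx'

theorem exists_isTilingFactorMap (hmin : IsMinimalShift (θ.X 0))
    (hex : ∀ n, ∃ φ : θ.X 0 → ZMod (lengthProd q n),
      Continuous φ ∧ ∀ x, φ (θ.shiftMap 0 x) = φ x + 1) :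
    ∃ π : θ.X 0 → Odometer q, θ.IsTilingFactorMap q π := by
  obtain ⟨x, hx⟩ := hmin.2.2.1
  set x₀ : θ.X 0 := ⟨x, hx⟩
  choose φ' hφc' hφ' using hex
  -- Normalising to vanish at `x₀` makes the coordinates coherent, since equivariant maps agreeing
  -- at one point coincide.
  set φ : ∀ n, θ.X 0 → ZMod (lengthProd q n) := fun n x => φ' n x - φ' n x₀ with hφdef
  have hφ0 : ∀ n, φ n x₀ = 0 := fun n => sub_self _
  have hφc : ∀ n, Continuous (φ n) := fun n => (hφc' n).sub continuous_const
  have hφ : ∀ n x, φ n (θ.shiftMap 0 x) = φ n x + 1 := fun n x => by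
    simp only [hφdef, hφ']; ring
  have hcompat : ∀ n, (fun x => ZMod.castHom (lengthProd_dvd_succ q n) (ZMod (lengthProd q n))
      (φ (n + 1) x)) = φ n := fun n =>
    equivariant_ext hmin (continuous_of_discreteTopology.comp (hφc (n + 1))) (hφc n)
      (fun x => by simp only [hφ, map_add, map_one]) (hφ n) (x₀ := x₀)
      (by simp only [hφ0, map_zero])
  refine ⟨fun x => ⟨fun n => φ n x, fun n => congrFun (hcompat n) x⟩,
    (continuous_pi hφc).subtype_mk _, fun z => ?_, fun x => Subtype.ext (funext fun n => hφ n x)⟩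
  have : CompactSpace (θ.X 0) := isCompact_iff_compactSpace.1 hmin.1.isCompact
  have hcl : ∀ n, IsClosed (φ n ⁻¹' {z.1 n}) := fun n => (isClosed_discrete _).preimage (hφc n)
  -- Surjectivity: the orbit of `x₀` meets every level set of every coordinate, and nested compact
  -- level sets have a common point.
  obtain ⟨y, hy⟩ := IsCompact.nonempty_iInter_of_sequence_nonempty_isCompact_isClosed
    (fun n => φ n ⁻¹' {z.1 n})
    (fun n y hy => by
      rw [mem_preimage, mem_singleton_iff] at hy ⊢
      rw [← congrFun (hcompat n) y, hy]
      exact z.2 n)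
    (fun n => by
      obtain ⟨k, hk⟩ := ZMod.intCast_surjective (z.1 n)
      refine ⟨⟨shiftBy k x₀.1, shiftBy_mem_X x₀.2 k⟩, ?_⟩
      rw [mem_preimage, mem_singleton_iff, map_shiftBy (hφ n), hφ0, zero_add, hk])
    (hcl 0).isCompact hcl
  rw [mem_iInter] at hy
  exact ⟨y, Subtype.ext (funext hy)⟩

theorem IsTorsionFree.isQuasiRecognizable (hb : θ.BoundedAlphabets) (htf : θ.IsTorsionFree q) :
    θ.IsQuasiRecognizable q :=
  ⟨htf.hasLength, htf.minimal,
    exists_isTilingFactorMap (htf.minimal 0) (exists_equivariant_map_lengthProd hb htf)⟩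

end DirectiveSequence

namespace DirectiveSequence

variable {θ θ' : DirectiveSequence.{u}} {q : ℕ → ℕ}

/-! ### Factors of directive sequences -/

variable (θ θ') in
/-- Letter-to-letter surjections `τ_n` that carry the morphisms of `θ` to those of `θ'`. -/
structure IsLetterFactor (τ : ∀ n, θ.Alphabet n → θ'.Alphabet n) : Prop where
  surjective : ∀ n, Function.Surjective (τ n)
  morphism_eq : ∀ n a, θ'.morphism n (τ (n + 1) a) = (θ.morphism n a).map (τ n)

namespace IsLetterFactor

variable {τ : ∀ n, θ.Alphabet n → θ'.Alphabet n}

theorem hasLengthSequence (hτ : IsLetterFactor θ θ' τ) (hq : θ.HasLengthSequence q) :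
    θ'.HasLengthSequence q := by
  intro n a
  obtain ⟨a, rfl⟩ := hτ.surjective (n + 1) a
  rw [hτ.morphism_eq, List.length_map, hq]

theorem expand_comp (hτ : IsLetterFactor θ θ' τ) (n : ℕ) (y : ℤ → θ.Alphabet (n + 1)) :
    θ'.expand q n (τ (n + 1) ∘ y) = τ n ∘ θ.expand q n y := by
  funext i
  simp only [expand, Function.comp, hτ.morphism_eq, List.head_map, List.getD_map]

theorem expandTo_comp (hτ : IsLetterFactor θ θ' τ) {m N : ℕ} (h : m ≤ N)
    (y : ℤ → θ.Alphabet N) : θ'.expandTo q h (τ N ∘ y) = τ m ∘ θ.expandTo q h y := by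
  induction N, h using Nat.le_induction with
  | base => rw [expandTo_self, expandTo_self]
  | succ N h ih => rw [expandTo_succ h, expandTo_succ h, hτ.expand_comp, ih]

/-- Only letters are lifted through `τ`: each window of a point of `X'^(n)` sits in the image of one
letter, whose lift gives a window over `θ`, and compactness assembles a preimage. -/
theorem X_eq_image (hτ : IsLetterFactor θ θ' τ) (hq : θ.HasLengthSequence q)
    (hpos : ∀ n, 0 < q n) (n : ℕ) : θ'.X n = (fun x => τ n ∘ x) '' θ.X n := by
  have hq' := hτ.hasLengthSequence hq
  ext x'
  constructor
  · intro hx'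
    have key : ∀ R : ℕ, ∃ u : ℤ → θ.Alphabet n, θ.IsWindow q n u (-R) R ∧
        ∀ i : ℤ, -R ≤ i → i < R → x' i = τ n (u i) := by
      intro R
      obtain ⟨N, hN, a', s, h1, h2, h3⟩ := (mem_X_iff hq' hpos).1 hx' R
      obtain ⟨a, rfl⟩ := hτ.surjective N a'
      refine ⟨shiftBy s (θ.expandTo q hN.le fun _ => a), ⟨N, hN, a, s, h1, h2, fun i _ _ => rfl⟩,
        fun i hi hi' => ?_⟩
      rw [h3 i hi hi']
      exact congrFun (hτ.expandTo_comp hN.le fun _ => a) (i + s)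
    choose u hu hu' using key
    obtain ⟨x, hx, h⟩ := exists_mem_X_eq_on_windows hq hpos u hu
    refine ⟨x, hx, funext fun i => ?_⟩
    obtain ⟨l, hl, hl'⟩ := h i.natAbs (i.natAbs + 1)
    simp only [Function.comp]
    rw [hu' l i (by omega) (by omega), hl' i (by omega) (by omega)]
  · rintro ⟨x, hx, rfl⟩
    rw [mem_X_iff hq' hpos]
    intro R
    obtain ⟨N, hN, a, s, h1, h2, h3⟩ := (mem_X_iff hq hpos).1 hx R
    refine ⟨N, hN, τ N a, s, h1, h2, fun i hi hi' => ?_⟩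
    simp only [Function.comp]
    rw [h3 i hi hi']
    exact (congrFun (hτ.expandTo_comp hN.le fun _ => a) (i + s)).symm

theorem continuous_comp (n : ℕ) : Continuous fun x : ℤ → θ.Alphabet n => τ n ∘ x :=
  continuous_pi fun i => continuous_of_discreteTopology.comp (continuous_apply i)

theorem isMinimalShift (hτ : IsLetterFactor θ θ' τ) (hq : θ.HasLengthSequence q)
    (hpos : ∀ n, 0 < q n) {n : ℕ} (hmin : IsMinimalShift (θ.X n)) : IsMinimalShift (θ'.X n) := by
  refine ⟨isClosed_X n, ?_, ?_, fun Y hY hYc hYs => ?_⟩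
  · rw [hτ.X_eq_image hq hpos, Set.image_image]
    conv_rhs => rw [← hmin.2.1, Set.image_image]
    rfl
  · rw [hτ.X_eq_image hq hpos]
    exact hmin.2.2.1.image _
  · rw [hτ.X_eq_image hq hpos] at hY ⊢
    have := hmin.2.2.2 (θ.X n ∩ (fun x => τ n ∘ x) ⁻¹' Y) Set.inter_subset_left
      (hmin.1.inter (hYc.preimage (continuous_comp n)))
      fun x hx => ⟨shift_mem θ n hx.1, hYs hx.2⟩
    rcases this with h | h
    · left
      refine Set.eq_empty_of_forall_notMem fun y hy => ?_
      obtain ⟨x, hx, rfl⟩ := hY hy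
      exact (h ▸ ⟨hx, hy⟩ : x ∈ (∅ : Set _))
    · right
      refine hY.antisymm ?_
      rintro _ ⟨x, hx, rfl⟩
      rw [← h] at hx
      exact hx.2

/-- If `τ_0` is bijective, a tiling factor map of `θ` is one of `θ'`, with the same fibres. -/
theorem exists_isTilingFactorMap (hτ : IsLetterFactor θ θ' τ) (hτ0 : Function.Injective (τ 0))
    (hq : θ.HasLengthSequence q) (hpos : ∀ n, 0 < q n) {π : θ.X 0 → Odometer q}
    (hπ : θ.IsTilingFactorMap q π) : ∃ π' : θ'.X 0 → Odometer q, θ'.IsTilingFactorMap q π' ∧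
      ∀ z, (π' ⁻¹' {z}).encard = (π ⁻¹' {z}).encard := by
  have himg := hτ.X_eq_image hq hpos 0
  let e : θ.X 0 ≃ θ'.X 0 := Equiv.ofBijective
    (fun x => ⟨τ 0 ∘ x.1, himg.superset ⟨x.1, x.2, rfl⟩⟩) ⟨fun x y h =>
      Subtype.ext (hτ0.comp_left (congrArg Subtype.val h)), fun x' => by
      obtain ⟨x, hx, hx'⟩ := himg.subset x'.2
      exact ⟨⟨x, hx⟩, Subtype.ext hx'⟩⟩
  have : CompactSpace (θ.X 0) := isCompact_iff_compactSpace.1 (isClosed_X 0).isCompact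
  have hec : Continuous e := ((continuous_comp 0).comp continuous_subtype_val).subtype_mk _
  have hes : Continuous e.symm := hec.continuous_symm_of_equiv_compact_to_t2
  refine ⟨π ∘ e.symm, ⟨hπ.continuous.comp hes, hπ.surjective.comp e.symm.surjective,
    fun x' => ?_⟩, fun z => ?_⟩
  · obtain ⟨x, rfl⟩ := e.surjective x'
    have : θ'.shiftMap 0 (e x) = e (θ.shiftMap 0 x) := rfl
    simp only [Function.comp, this, Equiv.symm_apply_apply, hπ.equivariant]
  · rw [Set.preimage_comp, ← e.image_eq_preimage_symm, e.injective.encard_image]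

end IsLetterFactor

/-! ### The injectivisation -/

theorem injectivisation_isLetterFactor (θ : DirectiveSequence.{u}) :
    IsLetterFactor θ θ.injectivisation fun n => Quotient.mk (θ.identify n) :=
  ⟨fun _ => Quotient.mk_surjective, fun _ _ => rfl⟩

theorem injectivisation_isInjective (θ : DirectiveSequence.{u}) : θ.injectivisation.IsInjective := by
  intro n a b
  induction a using Quotient.inductionOn with
  | h a =>
    induction b using Quotient.inductionOn with
    | h b => exact fun h => Quotient.sound h

theorem injective_mk_identify_zero (θ : DirectiveSequence.{u}) :
    Function.Injective (Quotient.mk (θ.identify 0)) := fun _ _ h => Quotient.exact h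

theorem injectivisation_fibre_encard (hq : θ.HasLengthSequence q)
    (hmin : ∀ n, IsMinimalShift (θ.X n)) {π : θ.X 0 → Odometer q}
    (hπ : θ.IsTilingFactorMap q π) :
    (∃ z, (π ⁻¹' {z}).encard = θ.injectivisation.naiveColumnNumber q) ∧
      ∀ k : ℕ, (k : ℕ∞) < θ.injectivisation.naiveColumnNumber q →
        ∀ z, (π ⁻¹' {z}).encard ≠ k := by
  have hpos := length_pos hq fun n => (hmin n).2.2.1
  have hτ := θ.injectivisation_isLetterFactor
  obtain ⟨π', hπ', hfib⟩ :=
    hτ.exists_isTilingFactorMap θ.injective_mk_identify_zero hq hpos hπ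
  simpa only [hfib] using fibre_encard (hτ.hasLengthSequence hq) θ.injectivisation_isInjective
    (fun n => hτ.isMinimalShift hq hpos (hmin n)) hπ'

end DirectiveSequence

end

theorem theorem6p4 (θ : DirectiveSequence.{u}) (q : ℕ → ℕ) (hq : θ.HasLengthSequence q)
    (hb : θ.BoundedAlphabets) :
    (θ.IsInjective → θ.IsQuasiRecognizable q →
      ∀ π : θ.X 0 → Odometer q, θ.IsTilingFactorMap q π →
        (∃ z, (π ⁻¹' {z}).encard = θ.naiveColumnNumber q) ∧
        ∀ k : ℕ, (k : ℕ∞) < θ.naiveColumnNumber q → ∀ z, (π ⁻¹' {z}).encard ≠ k) ∧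
    (θ.IsTorsionFree q →
      θ.IsQuasiRecognizable q ∧
      ∀ π : θ.X 0 → Odometer q, θ.IsTilingFactorMap q π →
        (∃ z, (π ⁻¹' {z}).encard = θ.injectivisation.naiveColumnNumber q) ∧
        ∀ k : ℕ, (k : ℕ∞) < θ.injectivisation.naiveColumnNumber q →
          ∀ z, (π ⁻¹' {z}).encard ≠ k) := by
  refine ⟨fun hinj hqr π hπ => DirectiveSequence.fibre_encard hq hinj hqr.minimal hπ,
    fun htf => ⟨htf.isQuasiRecognizable hb, fun π hπ =>
      DirectiveSequence.injectivisation_fibre_encard hq htf.minimal hπ⟩⟩
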